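/- Setting. Let $T$ be a non-empty compact Hausdorff space and $\mathcal A$ a collection of closed subsets of $T$ that contains $\emptyset$ and $T$, is closed under arbitrary intersections, contains no two disjoint non-empty sets, and is separable from above: there are finite sub-semilattices $\mathcal A_1\subseteq\mathcal A_2\subseteq\cdots$ of $\mathcal A$ and maps $g_n$ from $\mathcal A$ to finite unions of sets of $\mathcal A_n$ with $A=\bigcap_n g_n(A)$, $g_{n+1}(A)\subseteq g_n(A)$, $A\subseteq g_n(A)^{\circ}$, $g_n(\emptyset)=\emptyset$, which preserve arbitrary intersections and for which $\bigcup_i A_i=\bigcup_j A'_j$ (finite unions) implies $\bigcup_i g_n(A_i)=\bigcup_j g_n(A'_j)$. Let $\emptyset'$ be the intersection of all non-empty sets of $\mathcal A$, $\mathcal A(u)$ the class of finite unions of sets of $\mathcal A$, $\mathcal C=\{A\setminus B: A\in\mathcal A,\,B\in\mathcal A(u)\}$, and $\mathcal C(u)$ the class of finite unions of sets of $\mathcal C$. Orderings and flows. A consistent ordering of a finite non-empty sub-semilattice $\mathcal A'\subseteq\mathcal A\setminus\{\emptyset\}$ is an enumeration $A_1,\dots,A_n$ of the distinct sets of $\mathcal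 A'$ in which no set precedes one of its proper subsets; put $A_0=\emptyset'$. A flow is an increasing map $f$ from an interval to $\mathcal A(u)$; it is continuous if $f(t)=\bigcap_k f(t_k)$ whenever $t_k\downarrow t$ and $f(t)=\overline{\bigcup_k f(t_k)}$ whenever $t_k\uparrow t$. A simple flow is a continuous flow $f:[0,a]\to\mathcal A(u)$ with $f(0)=\emptyset'$ for which there are a partition $0=t_0<\dots<t_n=a$ and $\mathcal A$-valued flows $f_{i+1}$ on $[t_i,t_{i+1}]$ with $f(t)=\bigcup_{j=1}^{i}f_j(t_j)\cup f_{i+1}(t)$ on $[t_i,t_{i+1}]$. It connects the sets of the ordering $A_0,A_1,\dots,A_n$ along a partition $0=t_0<\dots<t_n=a$ if $f(t)=\bigcup_{j=1}^{i}A_j\cup f_{i+1}(t)$ on $[t_i,t_{i+1}]$ with continuous $\mathcal A$-valued flows $f_{i+1}$ such that $f_{i+1}(t_{i+1})=A_{i+1}$ (so $f(t_i)=\bigcup_{j=1}^iA_j$ for $i\ge1$). For each finite sub-semilattice and each consistent ordering of it, let one simple flow connecting its sets, and such a partition, be chosen, and let $\mathcal S$ be the collection of the chosen flows. Transition systems.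 A transition system indexed by a partially ordered set $I$ is a family of transition probabilities $Q_{st}(x;\Gamma)$ on $\mathbb R$, $s\le t$ in $I$, with $Q_{ss}(x;\cdot)=\delta_x$ and $Q_{rt}(x;\Gamma)=\int Q_{st}(y;\Gamma)\,Q_{rs}(x;dy)$ for $r\le s\le t$. It is called set-indexed if $I=\mathcal A(u)$, ordered by inclusion, and one-dimensional if $I=[0,a]$. A process $X=(X_A)_{A\in\mathcal A}$ with an almost surely unique additive extension to $\mathcal C(u)$ (defined by inclusion–exclusion on $\mathcal A(u)$, by $X_{A\setminus B}=X_A-X_{A\cap B}$ on $\mathcal C$, and by inclusion–exclusion on $\mathcal C(u)$; in particular $X_\emptyset=0$ a.s.) has the minimal filtration $\mathcal F_B=\sigma(X_A: A\in\mathcal A,A\subseteq B)$, $B\in\mathcal A(u)$. It is $\mathcal Q$-Markov, for a set-indexed transition system $\mathcal Q=(Q_{BB'})$, if $P[X_{B'}\in\Gamma\mid\mathcal F_B]=Q_{BB'}(X_B;\Gamma)$ a.s. for all $B\subseteq B'$ in $\mathcal A(u)$ and all Borel $\Gamma$. For a flow $f$ on $[0,a]$ and a transition system $\mathcal Q^f=(Q^f_{st})_{0\le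 s\le t\le a}$, the process $X^f=(X_{f(t)})_{t\in[0,a]}$ is $\mathcal Q^f$-Markov if $P[X_{f(t)}\in\Gamma\mid\mathcal F_{f(s)}]=Q^f_{st}(X_{f(s)};\Gamma)$ a.s. for all $0\le s\le t\le a$ and all Borel $\Gamma$. The initial distribution of $X$ is the law of $X_{\emptyset'}$. Corollary 1. Let $\mu$ be a probability measure on $\mathbb R$ and $\{\mathcal Q^f=(Q^f_{st})_{0\le s\le t\le a_f}: f\in\mathcal S\}$ one-dimensional transition systems, where $[0,a_f]$ is the domain of $f$, such that (matching) if $f,g\in\mathcal S$, $s\le t$ in $[0,a_f]$ and $u\le v$ in $[0,a_g]$ satisfy $f(s)=g(u)$ and $f(t)=g(v)$, then $Q^f_{st}=Q^g_{uv}$; (consistency) if $\{A_0=\emptyset',A_1,\dots,A_n\}$ and $\{A_0=\emptyset',A'_1,\dots,A'_n\}$ are two consistent orderings of the same finite sub-semilattice, $\pi$ is a permutation of $\{1,\dots,n\}$ with $\pi(1)=1$ and $A_i=A'_{\pi(i)}$, and $f,g$ are the chosen flows connecting them, with chosen partitions $(t_i)$, $(u_i)$, then for all Borel sets $\Gamma_0,\dots,\Gamma_n$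 $$\int I_{\Gamma_0}(x_0)I_{\Gamma_1}(x_1)\prod_{i=2}^nI_{\Gamma_i}(x_i-x_{i-1})\,Q^f_{t_{n-1}t_n}(x_{n-1};dx_n)\cdots Q^f_{0t_1}(x_0;dx_1)\,\mu(dx_0)$$ $$=\int I_{\Gamma_0}(y_0)I_{\Gamma_1}(y_1)\prod_{i=2}^nI_{\Gamma_i}(y_{\pi(i)}-y_{\pi(i)-1})\,Q^g_{u_{n-1}u_n}(y_{n-1};dy_n)\cdots Q^g_{0u_1}(y_0;dy_1)\,\mu(dy_0).$$ Then there exist a set-indexed transition system $\mathcal Q=(Q_{BB'})_{B\subseteq B'}$ and, on some complete probability space, a $\mathcal Q$-Markov process $X=(X_A)_{A\in\mathcal A}$ with initial distribution $\mu$ such that $X^f$ is $\mathcal Q^f$-Markov for every $f\in\mathcal S$. -/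

import Mathlib

open MeasureTheory ProbabilityTheory Set Filter Topology

universe u

noncomputable section

namespace SetIndexed

/-! ### The indexing collection -/

/-- The class of all finite unions of sets in `𝒟`. -/
def finiteUnions {T : Type*} (𝒟 : Set (Set T)) : Set (Set T) :=
  {B | ∃ F : Finset (Set T), (F : Set (Set T)) ⊆ 𝒟 ∧ B = ⋃₀ (F : Set (Set T))}

/-- The class `𝒞` of all sets `A \ B` with `A ∈ 𝒜` and `B ∈ 𝒜(u)`. -/
def differences {T : Type*} (𝒜 : Set (Set T)) : Set (Set T) :=
  {C | ∃ A ∈ 𝒜, ∃ B ∈ finiteUnions 𝒜, C = A \ B}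

/-- The minimal set `∅'`: the intersection of all non-empty sets of `𝒜`. -/
def minimalSet {T : Type*} (𝒜 : Set (Set T)) : Set T := ⋂₀ (𝒜 \ {∅})

/-- `𝒜` is separable from above: every `A ∈ 𝒜` is approximated from above by sets `g n A`, which
are finite unions of sets of a finite sub-semilattice `𝒟 n`. -/
def SeparableFromAbove {T : Type*} [TopologicalSpace T] (𝒜 : Set (Set T)) : Prop :=
  ∃ (g : ℕ → Set T → Set T) (𝒟 : ℕ → Set (Set T)),
    (∀ n, (𝒟 n).Finite ∧ 𝒟 n ⊆ 𝒜 ∧ ∀ A ∈ 𝒟 n, ∀ B ∈ 𝒟 n, A ∩ B ∈ 𝒟 n) ∧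
    (∀ n, 𝒟 n ⊆ 𝒟 (n + 1)) ∧
    (∀ n, ∀ A ∈ 𝒜, g n A ∈ finiteUnions (𝒟 n)) ∧
    (∀ A ∈ 𝒜, A = ⋂ n, g n A) ∧
    (∀ n, ∀ A ∈ 𝒜, g (n + 1) A ⊆ g n A ∧ A ⊆ interior (g n A)) ∧
    (∀ n, ∀ ℬ ⊆ 𝒜, g n (⋂₀ ℬ) = ⋂ A ∈ ℬ, g n A) ∧
    (∀ n, ∀ F F' : Finset (Set T), (F : Set (Set T)) ⊆ 𝒜 → (F' : Set (Set T)) ⊆ 𝒜 →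
      ⋃₀ (F : Set (Set T)) = ⋃₀ (F' : Set (Set T)) →
      ⋃ A ∈ F, g n A = ⋃ A ∈ F', g n A) ∧
    (∀ n, g n ∅ = ∅)

/-- The standing assumptions on the indexing semilattice `𝒜`. -/
structure IsIndexingCollection {T : Type*} [TopologicalSpace T] (𝒜 : Set (Set T)) : Prop where
  isClosed : ∀ A ∈ 𝒜, IsClosed A
  sInter_mem : ∀ ℬ ⊆ 𝒜, ⋂₀ ℬ ∈ 𝒜
  empty_mem : ∅ ∈ 𝒜
  univ_mem : univ ∈ 𝒜
  inter_nonempty : ∀ A ∈ 𝒜, ∀ B ∈ 𝒜, A.Nonempty → B.Nonempty → (A ∩ B).Nonempty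
  separable : SeparableFromAbove 𝒜

/-! ### Consistent orderings and flows -/

/-- `A 0 = ∅', A 1, …, A n` is a consistent ordering of the finite sub-semilattice
`{A 1, …, A n}` of (non-empty) sets of `𝒜`: the sets `A 1, …, A n` are distinct and no set is
numbered before one of its proper subsets. (In particular `A 1` is the intersection of the
sub-semilattice; `A 0` and `A 1` may coincide.) -/
structure IsConsistentOrdering {T : Type*} (𝒜 : Set (Set T)) {n : ℕ}
    (A : Fin (n + 1) → Set T) : Prop where
  pos : 0 < n
  zero : A 0 = minimalSet 𝒜
  mem : ∀ i, i ≠ 0 → A i ∈ 𝒜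
  nonempty : ∀ i, i ≠ 0 → (A i).Nonempty
  injective : ∀ i j, i ≠ 0 → j ≠ 0 → A i = A j → i = j
  inter : ∀ i j, i ≠ 0 → j ≠ 0 → ∃ k, k ≠ 0 ∧ A k = A i ∩ A j
  order : ∀ i j, i ≠ 0 → j ≠ 0 → A i ⊂ A j → i < j

/-- The union `A 1 ∪ … ∪ A i`. -/
def partialUnion {T : Type*} {n : ℕ} (A : Fin (n + 1) → Set T) (i : Fin (n + 1)) : Set T :=
  ⋃ j, ⋃ (_ : 0 < j ∧ j ≤ i), A j

/-- `f : [a, b] → 𝒟` is increasing. -/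
def IsFlowOn {T : Type*} (𝒟 : Set (Set T)) (f : ℝ → Set T) (a b : ℝ) : Prop :=
  (∀ t ∈ Icc a b, f t ∈ 𝒟) ∧ MonotoneOn f (Icc a b)

/-- Continuity of a flow on `[a, b]`. -/
def IsContinuousOn {T : Type*} [TopologicalSpace T] (f : ℝ → Set T) (a b : ℝ) : Prop :=
  ∀ t ∈ Icc a b, ∀ s : ℕ → ℝ, (∀ k, s k ∈ Icc a b) → Tendsto s atTop (𝓝 t) →
    (Antitone s → f t = ⋂ k, f (s k)) ∧ (Monotone s → f t = closure (⋃ k, f (s k)))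

/-- A set-valued path `[0, a] → Set T`; the values of `toFun` outside `[0, a]` play no role. -/
structure Path (T : Type*) where
  a : ℝ
  toFun : ℝ → Set T

/-- `0 = τ 0 < τ 1 < … < τ n = a`. -/
def IsPartition {n : ℕ} (τ : Fin (n + 1) → ℝ) (a : ℝ) : Prop :=
  τ 0 = 0 ∧ τ (Fin.last n) = a ∧ StrictMono τ

/-- `f` is a simple flow: a continuous flow `[0, a] → 𝒜(u)` which starts at `∅'` and is piecewise
`𝒜`-valued. -/
def IsSimpleFlow {T : Type*} [TopologicalSpace T] (𝒜 : Set (Set T)) (f : Path T) : Prop :=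
  IsFlowOn (finiteUnions 𝒜) f.toFun 0 f.a ∧ IsContinuousOn f.toFun 0 f.a ∧
  f.toFun 0 = minimalSet 𝒜 ∧
  ∃ (n : ℕ) (τ : Fin (n + 1) → ℝ) (φ : Fin n → ℝ → Set T), IsPartition τ f.a ∧
    ∀ i : Fin n, IsFlowOn 𝒜 (φ i) (τ i.castSucc) (τ i.succ) ∧
      ∀ t ∈ Icc (τ i.castSucc) (τ i.succ),
        f.toFun t = (⋃ j, ⋃ (_ : j < i), φ j (τ j.succ)) ∪ φ i t

/-- The simple flow `f` connects the sets of the ordering `A`, along the partition `τ` of its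
domain: on `[τ i, τ (i+1)]` it equals `A 1 ∪ … ∪ A i ∪ φ (i+1)`, where `φ (i+1)` is a
continuous `𝒜`-valued flow which ends at `A (i+1)`. In particular `f (τ i) = A 1 ∪ … ∪ A i`. -/
def Connects {T : Type*} [TopologicalSpace T] (𝒜 : Set (Set T)) {n : ℕ}
    (A : Fin (n + 1) → Set T) (f : Path T) (τ : Fin (n + 1) → ℝ) : Prop :=
  IsSimpleFlow 𝒜 f ∧ IsPartition τ f.a ∧
  ∃ φ : Fin n → ℝ → Set T, ∀ i : Fin n,
    IsFlowOn 𝒜 (φ i) (τ i.castSucc) (τ i.succ) ∧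
    IsContinuousOn (φ i) (τ i.castSucc) (τ i.succ) ∧
    φ i (τ i.succ) = A i.succ ∧
    ∀ t ∈ Icc (τ i.castSucc) (τ i.succ), f.toFun t = partialUnion A i.castSucc ∪ φ i t

/-- The collection `𝒮` of the chosen flows, one for each consistent ordering. -/
def chosenFlows {T : Type*} (𝒜 : Set (Set T))
    (F : (n : ℕ) → (Fin (n + 1) → Set T) → Path T) : Set (Path T) :=
  {f | ∃ (n : ℕ) (A : Fin (n + 1) → Set T), IsConsistentOrdering 𝒜 A ∧ f = F n A}

/-! ### Transition systems and their consistency -/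

/-- `(Q s t)`, `s ≤ t` in `I`, is a transition system on `ℝ`. It is used for `I = 𝒜(u)` ordered
by inclusion, and for `I = [0, a]`. -/
structure IsTransitionSystem {ι : Type*} [Preorder ι] (I : Set ι)
    (Q : ι → ι → Kernel ℝ ℝ) : Prop where
  markov : ∀ s ∈ I, ∀ t ∈ I, s ≤ t → IsMarkovKernel (Q s t)
  refl : ∀ s ∈ I, Q s s = Kernel.id
  comp : ∀ r ∈ I, ∀ s ∈ I, ∀ t ∈ I, r ≤ s → s ≤ t → Q r t = Q s t ∘ₖ Q r s

/-- The law `K (n-1) (x (n-1)) (dx n) ⋯ K 0 (x 0) (dx 1) μ (dx 0)` on `ℝ ^ (n + 1)`. -/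
def chainLaw (μ : Measure ℝ) : (n : ℕ) → (Fin n → Kernel ℝ ℝ) → Measure (Fin (n + 1) → ℝ)
  | 0, _ => μ.map (fun x _ => x)
  | n + 1, K =>
    (chainLaw μ n (fun i => K i.castSucc) ⊗ₘ
      (K (Fin.last n)).comap (fun x : Fin (n + 1) → ℝ => x (Fin.last n))
        (measurable_pi_apply _)).map
      (fun p => (Fin.snoc p.1 p.2 : Fin (n + 2) → ℝ))

/-- `x 0, x 1, x 2 - x 1, …, x n - x (n - 1)`. -/
def increment {n : ℕ} (x : Fin (n + 1) → ℝ) (i : Fin (n + 1)) : ℝ :=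
  if (i : ℕ) ≤ 1 then x i else x i - x (i - 1)

/-- Matching: the transition probability of `Q f` between two times depends only on the sets at
which the flow `f ∈ 𝒮` is at these times. -/
def Matching {T : Type*} (S : Set (Path T)) (Q : Path T → ℝ → ℝ → Kernel ℝ ℝ) : Prop :=
  ∀ f ∈ S, ∀ g ∈ S, ∀ s ∈ Icc 0 f.a, ∀ t ∈ Icc 0 f.a, ∀ u ∈ Icc 0 g.a, ∀ v ∈ Icc 0 g.a,
    s ≤ t → u ≤ v → f.toFun s = g.toFun u → f.toFun t = g.toFun v → Q f s t = Q g u v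

/-- Consistency: the law of the increments over the left neighbourhoods of a finite
sub-semilattice does not depend on its consistent ordering. -/
def Consistency {T : Type*} (𝒜 : Set (Set T)) (μ : Measure ℝ)
    (F : (n : ℕ) → (Fin (n + 1) → Set T) → Path T)
    (τ : (n : ℕ) → (Fin (n + 1) → Set T) → Fin (n + 1) → ℝ)
    (Q : Path T → ℝ → ℝ → Kernel ℝ ℝ) : Prop :=
  ∀ (n : ℕ) (A A' : Fin (n + 1) → Set T), IsConsistentOrdering 𝒜 A → IsConsistentOrdering 𝒜 A' →
    ∀ π : Equiv.Perm (Fin (n + 1)), π 0 = 0 → π 1 = 1 → (∀ i, A i = A' (π i)) →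
    ∀ Γ : Fin (n + 1) → Set ℝ, (∀ i, MeasurableSet (Γ i)) →
      chainLaw μ n (fun i => Q (F n A) (τ n A i.castSucc) (τ n A i.succ))
          {x | ∀ i, increment x i ∈ Γ i} =
        chainLaw μ n (fun i => Q (F n A') (τ n A' i.castSucc) (τ n A' i.succ))
          {y | ∀ i, increment y (π i) ∈ Γ i}

/-! ### Set-indexed processes

A real process `(X A)`, `A ∈ 𝒜`, on `Ω` is given by `X : Set T → Ω → ℝ`; only its values on `𝒜`
are ever used. -/

/-- The inclusion-exclusion sum `∑ x (A_i) - ∑ x (A_i ∩ A_j) + …` over a finite family of sets. -/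
def inclExcl {T : Type*} (x : Set T → ℝ) (F : Finset (Set T)) : ℝ :=
  ∑ G ∈ F.powerset.filter (fun G => G.Nonempty),
    (-1) ^ (G.card + 1) * x (⋂₀ (G : Set (Set T)))

open Classical in
/-- The extension of `x` to `B ∈ 𝒜(u)`, through some representation of `B`. -/
def extU {T : Type*} (𝒜 : Set (Set T)) (x : Set T → ℝ) (B : Set T) : ℝ :=
  if h : ∃ F : Finset (Set T), (F : Set (Set T)) ⊆ 𝒜 ∧ B = ⋃₀ (F : Set (Set T)) then
    inclExcl x h.choose else 0

open Classical in
/-- The extension of `x` to `C ∈ 𝒞`, through some representation `C = A \ B`. -/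
def extC {T : Type*} (𝒜 : Set (Set T)) (x : Set T → ℝ) (C : Set T) : ℝ :=
  if h : ∃ p : Set T × Set T, p.1 ∈ 𝒜 ∧ p.2 ∈ finiteUnions 𝒜 ∧ C = p.1 \ p.2 then
    x h.choose.1 - extU 𝒜 x (h.choose.1 ∩ h.choose.2) else 0

/-- `X` has an almost surely unique additive extension to `𝒜(u)`, to `𝒞` and to `𝒞(u)`. -/
structure HasUniqueAdditiveExtension {T Ω : Type*} [MeasurableSpace Ω] (𝒜 : Set (Set T))
    (P : Measure Ω) (X : Set T → Ω → ℝ) : Prop where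
  toU : ∀ F F' : Finset (Set T), (F : Set (Set T)) ⊆ 𝒜 → (F' : Set (Set T)) ⊆ 𝒜 →
    ⋃₀ (F : Set (Set T)) = ⋃₀ (F' : Set (Set T)) →
    ∀ᵐ ω ∂P, inclExcl (fun A => X A ω) F = inclExcl (fun A => X A ω) F'
  toC : ∀ A ∈ 𝒜, ∀ A' ∈ 𝒜, ∀ B ∈ finiteUnions 𝒜, ∀ B' ∈ finiteUnions 𝒜, A \ B = A' \ B' →
    ∀ᵐ ω ∂P, X A ω - extU 𝒜 (fun D => X D ω) (A ∩ B) =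
      X A' ω - extU 𝒜 (fun D => X D ω) (A' ∩ B')
  toCu : ∀ F F' : Finset (Set T), (F : Set (Set T)) ⊆ differences 𝒜 →
    (F' : Set (Set T)) ⊆ differences 𝒜 →
    ⋃₀ (F : Set (Set T)) = ⋃₀ (F' : Set (Set T)) →
    ∀ᵐ ω ∂P, inclExcl (extC 𝒜 (fun A => X A ω)) F = inclExcl (extC 𝒜 (fun A => X A ω)) F'

/-- The value `X B` of the process at `B ∈ 𝒜(u)`. -/
def valueAt {T Ω : Type*} (𝒜 : Set (Set T)) (X : Set T → Ω → ℝ) (B : Set T) (ω : Ω) : ℝ :=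
  extU 𝒜 (fun A => X A ω) B

/-- The minimal filtration `ℱ B = σ(X A; A ∈ 𝒜, A ⊆ B)`. -/
@[reducible] def minFiltration {T Ω : Type*} (𝒜 : Set (Set T)) (X : Set T → Ω → ℝ) (B : Set T) :
    MeasurableSpace Ω :=
  ⨆ A, ⨆ (_ : A ∈ 𝒜 ∧ A ⊆ B), MeasurableSpace.comap (X A) (borel ℝ)

/-- `P[Y t ∈ Γ | ℱ s] = Q s t (Y s; Γ)` almost surely, for all `s ≤ t` in `I`. -/
def MarkovWith {ι Ω : Type*} [Preorder ι] [MeasurableSpace Ω] (P : Measure Ω) (I : Set ι)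
    (ℱ : ι → MeasurableSpace Ω) (Y : ι → Ω → ℝ) (Q : ι → ι → Kernel ℝ ℝ) : Prop :=
  ∀ s ∈ I, ∀ t ∈ I, s ≤ t → ∀ Γ : Set ℝ, MeasurableSet Γ →
    P⟦Y t ⁻¹' Γ | ℱ s⟧ =ᵐ[P] fun ω => (Q s t (Y s ω)).real Γ

/-- `X` is a `Q`-Markov process indexed by `𝒜`. -/
structure IsQMarkov {T Ω : Type*} [MeasurableSpace Ω] (𝒜 : Set (Set T)) (P : Measure Ω)
    (X : Set T → Ω → ℝ) (Q : Set T → Set T → Kernel ℝ ℝ) : Prop where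
  measurable : ∀ A ∈ 𝒜, Measurable (X A)
  additive : HasUniqueAdditiveExtension 𝒜 P X
  markov : MarkovWith P (finiteUnions 𝒜) (minFiltration 𝒜 X) (valueAt 𝒜 X) Q

/-- `X ∘ f` is `Q`-Markov on `[0, a]` with respect to the filtration `(ℱ (f t))`. -/
def IsQMarkovAlong {T Ω : Type*} [MeasurableSpace Ω] (𝒜 : Set (Set T)) (P : Measure Ω)
    (X : Set T → Ω → ℝ) (f : Path T) (Q : ℝ → ℝ → Kernel ℝ ℝ) : Prop :=
  MarkovWith P (Icc 0 f.a) (fun t => minFiltration 𝒜 X (f.toFun t))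
    (fun t => valueAt 𝒜 X (f.toFun t)) Q

end SetIndexed

end

/-!
The process is built from its finite-dimensional distributions by Kolmogorov's extension theorem
(`exists_isProjectiveLimit`).

Every chain of sets in `𝒜(u) \ {∅}` is visited by one of the chosen flows: a finite semilattice that
generates the chain has a consistent ordering in which the sets below the first member of the chain
come first, then those below the second, and so on (`exists_ordering_isCut`). By matching, the
transition probabilities of the flows therefore define kernels `Q B B'` for `∅ ≠ B ⊆ B'`, and the
Chapman-Kolmogorov equations hold because three nested sets lie on one flow. From `∅` the system
jumps to `∅'` with law `μ` (`setKernel`, `isTransitionSystem_setKernel`). After that flows play no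
role, since `Q (f s) (f t)` is the transition probability of `f` from `s` to `t`.

For a consistent ordering `A`, the chain with transition probabilities `Q` along the unions `A 0 ∪
… ∪ A i` gives the values of the process at these unions; its increments are the values on the
left neighbourhoods, and the value at `D` is the sum of the increments over the left
neighbourhoods inside `D` (`valueOf`). A left neighbourhood may be empty, but then two successive
unions coincide and the chain does not move. Hence almost surely the whole finite picture is the
restriction of a finite signed point measure on `T` (`exists_pointMass_eq`,
`ae_exists_pointMass`). This one fact makes all additivity statements identities between values of
a measure: that the value at a union is given by the chain, that refining the ordering does not
change the law (`valueLaw_marginal_of_isCut`), and that the extensions to `𝒜(u)`, `𝒞` and `𝒞(u)`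
are almost surely unique (`hasUniqueAdditiveExtension`). It passes to the process because the
restrictions of point measures to finitely many sets form a finite-dimensional, hence closed,
subspace.

Consistency says that the law on a semilattice does not depend on its ordering; with the refinement
step the laws form a projective family (`valueLaw_marginal_eq`). The Markov property between
`B ⊆ B'` is read off an ordering that is cut at `B` and `B'` and contains the finitely many sites
observed in the past (`lintegral_markov`), and extends to the whole past by a π-system argument.
-/

noncomputable section

namespace SetIndexed

open scoped ENNReal

/-! ### Kolmogorov's extension theorem for real-valued families -/

/-- A countable family of cylinders over compact sets, all of whose finite subfamilies meet, has a
common point: an ultrafilter limit of points of the finite intersections, taken coordinatewise. -/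
theorem nonempty_iInter_cylinder {ι : Type*} (I : ℕ → Finset ι) (K : ∀ n, Set (I n → ℝ))
    (hK : ∀ n, IsCompact (K n)) (x : ℕ → ι → ℝ)
    (hx : ∀ n, ∀ k ≤ n, x n ∈ cylinder (α := fun _ : ι => ℝ) (I k) (K k)) :
    (⋂ n, cylinder (α := fun _ : ι => ℝ) (I n) (K n)).Nonempty := by
  have hlim : ∀ i : ι, ∃ y : ℝ, ∀ k, i ∈ I k →
      Tendsto (fun n => x n i) (hyperfilter ℕ : Filter ℕ) (𝓝 y) := by
    intro i
    by_cases h : ∃ k, i ∈ I k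
    · obtain ⟨k, hk⟩ := h
      have hc : IsCompact ((fun v : I k → ℝ => v ⟨i, hk⟩) '' K k) :=
        (hK k).image (continuous_apply _)
      obtain ⟨y, -, hy⟩ := hc.ultrafilter_le_nhds ((hyperfilter ℕ).map (fun n => x n i)) (by
        rw [le_principal_iff]
        change (fun n => x n i) ⁻¹' _ ∈ hyperfilter ℕ
        have : ∀ᶠ n in (hyperfilter ℕ : Filter ℕ), k ≤ n :=
          Nat.hyperfilter_le_atTop (eventually_ge_atTop k)
        filter_upwards [this] with n hn
        exact ⟨_, hx n k hn, rfl⟩)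
      exact ⟨y, fun _ _ => hy⟩
    · exact ⟨0, fun k hk => absurd ⟨k, hk⟩ h⟩
  choose y hy using hlim
  refine ⟨y, mem_iInter.2 fun k => ?_⟩
  change (I k).restrict y ∈ K k
  refine (hK k).isClosed.mem_of_tendsto (f := fun n => (I k).restrict (x n))
    (b := (hyperfilter ℕ : Filter ℕ)) ?_ ?_
  · exact tendsto_pi_nhds.2 fun i => hy i k i.2
  · have : ∀ᶠ n in (hyperfilter ℕ : Filter ℕ), k ≤ n :=
      Nat.hyperfilter_le_atTop (eventually_ge_atTop k)
    filter_upwards [this] with n hn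
    exact hx n k hn

/-- The content of a projective family of probability measures is continuous at `∅`. -/
theorem tendsto_projectiveFamilyContent_zero {ι : Type*} {P : ∀ J : Finset ι, Measure (J → ℝ)}
    [∀ J, IsProbabilityMeasure (P J)]
    (hP : IsProjectiveMeasureFamily (α := fun _ : ι => ℝ) P) {s : ℕ → Set (ι → ℝ)}
    (hs : ∀ n, s n ∈ measurableCylinders (fun _ : ι => ℝ)) (hanti : Antitone s)
    (hinter : ⋂ n, s n = ∅) :
    Tendsto (fun n => projectiveFamilyContent hP (s n)) atTop (𝓝 0) := by
  have hmono : Antitone (fun n => projectiveFamilyContent hP (s n)) := fun m n hmn =>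
    projectiveFamilyContent_mono hP (hs n) (hs m) (hanti hmn)
  have hle : ∀ ε : ℝ≥0∞, ε ≠ 0 → ⨅ n, projectiveFamilyContent hP (s n) ≤ ε := by
    intro ε hε
    by_contra! hcon
    obtain ⟨δ, hδ, hsum⟩ := ENNReal.exists_pos_sum_of_countable' hε ℕ
    choose I S hS hsI using fun n => (mem_measurableCylinders _).1 (hs n)
    have hcompact : ∀ n, ∃ K ⊆ S n, IsCompact K ∧ P (I n) (S n \ K) < δ n := fun n =>
      (hS n).exists_isCompact_sdiff_lt (measure_ne_top _ _) (hδ n).ne'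
    choose K hKS hK hPK using hcompact
    have hCm : ∀ n, cylinder (α := fun _ : ι => ℝ) (I n) (K n) ∈
        measurableCylinders (fun _ : ι => ℝ) := fun n =>
      cylinder_mem_measurableCylinders _ _ (hK n).isClosed.measurableSet
    -- the compact cylinders lose too little mass for their finite intersections to be empty
    have hne : ∀ n, ∃ x : ι → ℝ, ∀ k ≤ n, x ∈ cylinder (α := fun _ : ι => ℝ) (I k) (K k) := by
      intro n
      by_contra! hempty
      have hdm : ∀ k, s k \ cylinder (α := fun _ : ι => ℝ) (I k) (K k) ∈
          measurableCylinders (fun _ : ι => ℝ) :=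
        fun k => isSetRing_measurableCylinders.sdiff_mem (hs k) (hCm k)
      have hsub : s n ⊆ ⋃ k ≤ n, (s k \ cylinder (α := fun _ : ι => ℝ) (I k) (K k)) := by
        intro x hx
        obtain ⟨k, hk, hxk⟩ := hempty x
        exact mem_iUnion₂.2 ⟨k, hk, hanti hk hx, hxk⟩
      have hUm : (⋃ k ≤ n, (s k \ cylinder (α := fun _ : ι => ℝ) (I k) (K k))) ∈
          measurableCylinders (fun _ : ι => ℝ) := by
        have := isSetRing_measurableCylinders.biUnion_mem
          (s := fun k => s k \ cylinder (α := fun _ : ι => ℝ) (I k) (K k))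
          (Finset.range (n + 1)) (fun k _ => hdm k)
        simpa only [Finset.mem_range_succ_iff] using this
      have hval : ∀ k, projectiveFamilyContent hP
          (s k \ cylinder (α := fun _ : ι => ℝ) (I k) (K k)) ≤ δ k := by
        intro k
        rw [projectiveFamilyContent_congr hP (I := I k) (S := S k \ K k) _ ?_
          ((hS k).diff (hK k).isClosed.measurableSet)]
        · exact (hPK k).le
        · rw [hsI k]; rfl
      have := calc
        projectiveFamilyContent hP (s n) ≤ projectiveFamilyContent hP
              (⋃ k ≤ n, (s k \ cylinder (α := fun _ : ι => ℝ) (I k) (K k))) :=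
            projectiveFamilyContent_mono hP (hs n) hUm hsub
        _ ≤ ∑ k ∈ Finset.range (n + 1), projectiveFamilyContent hP
              (s k \ cylinder (α := fun _ : ι => ℝ) (I k) (K k)) :=
            projectiveFamilyContent_iUnion_le hP hdm n
        _ ≤ ∑ k ∈ Finset.range (n + 1), δ k := Finset.sum_le_sum fun k _ => hval k
        _ ≤ ∑' k, δ k := ENNReal.sum_le_tsum _
      exact absurd (((iInf_le _ n).trans this).trans hsum.le) (not_le.2 hcon)
    choose x hx using hne
    obtain ⟨y, hy⟩ := nonempty_iInter_cylinder I K hK x hx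
    have : y ∈ ⋂ n, s n := mem_iInter.2 fun n => by
      rw [hsI n]; exact hKS n (mem_iInter.1 hy n)
    rw [hinter] at this
    exact this
  have h0 : ⨅ n, projectiveFamilyContent hP (s n) = 0 := by
    by_contra hne
    obtain ⟨ε, hε, hlt⟩ := exists_between (pos_iff_ne_zero.2 hne)
    exact absurd (hle ε hε.ne') (not_le.2 hlt)
  rw [← h0]
  exact tendsto_atTop_iInf hmono

/-- **Kolmogorov's extension theorem** for real-valued families. -/
theorem exists_isProjectiveLimit {ι : Type*} {P : ∀ J : Finset ι, Measure (J → ℝ)}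
    [∀ J, IsProbabilityMeasure (P J)] (hP : IsProjectiveMeasureFamily (α := fun _ : ι => ℝ) P) :
    ∃ ν : Measure (ι → ℝ), IsProjectiveLimit (α := fun _ : ι => ℝ) ν P := by
  have hsub : (projectiveFamilyContent hP).IsSigmaSubadditive :=
    isSigmaSubadditive_of_addContent_iUnion_eq_tsum isSetRing_measurableCylinders
      fun f hf hU hd => addContent_iUnion_eq_sum_of_tendsto_zero isSetRing_measurableCylinders
        _ (fun s _ => projectiveFamilyContent_ne_top hP)
        (fun s hs ha hi => tendsto_projectiveFamilyContent_zero hP hs ha hi) hf hU hd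
  refine ⟨(projectiveFamilyContent hP).measure isSetSemiring_measurableCylinders
    generateFrom_measurableCylinders.ge hsub, fun I => ?_⟩
  ext s hs
  rw [Measure.map_apply (Finset.measurable_restrict I) hs, AddContent.measure_eq,
    ← cylinder, projectiveFamilyContent_cylinder hP hs]
  · exact generateFrom_measurableCylinders.symm
  · exact cylinder_mem_measurableCylinders _ _ hs

/-! ### Markov chains with prescribed transition probabilities -/

theorem measurable_snoc_prod (n : ℕ) :
    Measurable (fun p : (Fin (n + 1) → ℝ) × ℝ => (Fin.snoc p.1 p.2 : Fin (n + 2) → ℝ)) := by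
  refine measurable_pi_iff.2 fun i => ?_
  refine Fin.lastCases ?_ (fun j => ?_) i
  · simpa using measurable_snd
  · simp only [Fin.snoc_castSucc]
    fun_prop

theorem measurable_mul_eval {n : ℕ} {g : (Fin n → ℝ) → ℝ≥0∞} (hg : Measurable g)
    {h : ℝ → ℝ≥0∞} (hh : Measurable h) (i : Fin n) : Measurable (fun x => g x * h (x i)) :=
  hg.mul (hh.comp (measurable_pi_apply i))

theorem isProbabilityMeasure_chainLaw (μ : Measure ℝ) [IsProbabilityMeasure μ] (n : ℕ)
    (K : Fin n → Kernel ℝ ℝ) [∀ i, IsMarkovKernel (K i)] :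
    IsProbabilityMeasure (chainLaw μ n K) := by
  induction n with
  | zero =>
    exact Measure.isProbabilityMeasure_map (by fun_prop)
  | succ n ih =>
    have := ih (fun i => K i.castSucc)
    exact Measure.isProbabilityMeasure_map (measurable_snoc_prod n).aemeasurable

/-- One more step of the chain: the last coordinate is integrated first, given the others. -/
theorem lintegral_chainLaw_succ (μ : Measure ℝ) [IsProbabilityMeasure μ] (n : ℕ)
    (K : Fin (n + 1) → Kernel ℝ ℝ) [∀ i, IsMarkovKernel (K i)]
    {f : (Fin (n + 2) → ℝ) → ℝ≥0∞} (hf : Measurable f) :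
    ∫⁻ x, f x ∂chainLaw μ (n + 1) K =
      ∫⁻ x, ∫⁻ y, f (Fin.snoc x y) ∂K (Fin.last n) (x (Fin.last n))
        ∂chainLaw μ n (fun i => K i.castSucc) := by
  have := isProbabilityMeasure_chainLaw μ n (fun i => K i.castSucc)
  rw [chainLaw, lintegral_map hf (measurable_snoc_prod n),
    Measure.lintegral_compProd (f := fun p => f (Fin.snoc p.1 p.2))
      (hf.comp (measurable_snoc_prod n))]
  rfl

/-- The Markov property of the chain with transition probabilities `Q (U i) (U (i + 1))`, over any
number of steps. -/
theorem lintegral_chainLaw_mul {ι : Type*} [Preorder ι] {I : Set ι} {Q : ι → ι → Kernel ℝ ℝ}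
    (hQ : IsTransitionSystem I Q) [∀ s t, IsMarkovKernel (Q s t)]
    (μ : Measure ℝ) [IsProbabilityMeasure μ] {n : ℕ} (U : Fin (n + 1) → ι) (hU : Monotone U)
    (hUI : ∀ i, U i ∈ I) {i j : Fin (n + 1)} (hij : i ≤ j) {g : (Fin (n + 1) → ℝ) → ℝ≥0∞}
    (hg : Measurable g) (hgi : DependsOn g (Set.Iic i)) {h : ℝ → ℝ≥0∞} (hh : Measurable h) :
    ∫⁻ x, g x * h (x j) ∂chainLaw μ n (fun i => Q (U i.castSucc) (U i.succ)) =
      ∫⁻ x, g x * ∫⁻ y, h y ∂Q (U i) (U j) (x i)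
        ∂chainLaw μ n (fun i => Q (U i.castSucc) (U i.succ)) := by
  induction n generalizing h with
  | zero =>
    obtain rfl : i = j := by omega
    simp [hQ.refl _ (hUI i), Kernel.id_apply, lintegral_dirac' _ hh]
  | succ n ih =>
    have hmk : ∀ s t, Measurable (fun x => ∫⁻ y, h y ∂Q s t x) := fun s t => hh.lintegral_kernel
    by_cases hil : i = Fin.last (n + 1)
    · obtain rfl : j = i := le_antisymm (hil ▸ Fin.le_last j) hij
      simp [hQ.refl _ (hUI j), Kernel.id_apply, lintegral_dirac' _ hh]
    obtain ⟨i, rfl⟩ := Fin.exists_castSucc_eq.2 hil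
    have hg' : ∀ x : Fin (n + 1) → ℝ, ∀ y : ℝ,
        g (Fin.snoc x y : Fin (n + 2) → ℝ) = g (Fin.snoc x 0 : Fin (n + 2) → ℝ) := by
      intro x y
      refine hgi fun k hk => ?_
      obtain ⟨k, rfl⟩ := Fin.exists_castSucc_eq.2
        (fun h : k = Fin.last _ => absurd (h ▸ hk) (not_le.2 (Fin.castSucc_lt_last i)))
      simp
    have hg'm : Measurable (fun x : Fin (n + 1) → ℝ => g (Fin.snoc x 0 : Fin (n + 2) → ℝ)) :=
      hg.comp ((measurable_snoc_prod n).comp (measurable_id.prodMk measurable_const))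
    have hg'd : DependsOn (fun x : Fin (n + 1) → ℝ => g (Fin.snoc x 0 : Fin (n + 2) → ℝ))
        (Set.Iic i) := by
      intro x x' hxx
      refine hgi fun k hk => ?_
      obtain ⟨k, rfl⟩ := Fin.exists_castSucc_eq.2
        (fun h : k = Fin.last _ => absurd (h ▸ hk) (not_le.2 (Fin.castSucc_lt_last i)))
      simpa using hxx k hk
    have hU' : Monotone (fun i : Fin (n + 1) => U i.castSucc) := fun a b hab => hU hab
    rw [lintegral_chainLaw_succ _ _ _ (measurable_mul_eval hg hh j),
      lintegral_chainLaw_succ _ _ _ (measurable_mul_eval hg (hmk _ _) _)]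
    simp only [hg', Fin.snoc_castSucc, lintegral_const, measure_univ, mul_one]
    by_cases hjl : j = Fin.last (n + 1)
    · subst hjl
      simp only [Fin.snoc_last]
      have h1 : ∀ x : Fin (n + 1) → ℝ, ∫⁻ y, g (Fin.snoc x 0 : Fin (n + 2) → ℝ) * h y
          ∂Q (U (Fin.last n).castSucc) (U (Fin.last n).succ) (x (Fin.last n)) =
          g (Fin.snoc x 0 : Fin (n + 2) → ℝ) *
          ∫⁻ y, h y ∂Q (U (Fin.last n).castSucc) (U (Fin.last n).succ) (x (Fin.last n)) :=
        fun x => lintegral_const_mul _ hh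
      simp only [h1]
      refine (ih (fun i => U i.castSucc) hU' (fun i => hUI _) (Fin.le_last i) hg'm hg'd
        (hmk _ _)).trans ?_
      refine lintegral_congr fun x => ?_
      congr 1
      rw [← Kernel.lintegral_comp _ _ _ hh]
      rw [← hQ.comp _ (hUI _) _ (hUI _) _ (hUI _) (hU' (Fin.le_last i))
        (hU (Fin.castSucc_le_succ _))]
      rfl
    · obtain ⟨j, rfl⟩ := Fin.exists_castSucc_eq.2 hjl
      simp only [Fin.snoc_castSucc, lintegral_const, measure_univ, mul_one]
      exact ih (fun i => U i.castSucc) hU' (fun i => hUI _) hij hg'm hg'd hh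

/-- The law of a chain is determined by its initial law and its one-step Markov property. -/
theorem eq_chainLaw (μ : Measure ℝ) [IsProbabilityMeasure μ] {n : ℕ}
    (K : Fin n → Kernel ℝ ℝ) [∀ i, IsMarkovKernel (K i)] (M : Measure (Fin (n + 1) → ℝ))
    [IsProbabilityMeasure M] (h0 : M.map (fun x => x 0) = μ)
    (hM : ∀ i : Fin n, ∀ g : (Fin (n + 1) → ℝ) → ℝ≥0∞, Measurable g →
      DependsOn g (Set.Iic i.castSucc) → ∀ h : ℝ → ℝ≥0∞, Measurable h →
      ∫⁻ x, g x * h (x i.succ) ∂M = ∫⁻ x, g x * ∫⁻ y, h y ∂K i (x i.castSucc) ∂M) :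
    M = chainLaw μ n K := by
  induction n with
  | zero =>
    rw [chainLaw, ← h0, Measure.map_map (by fun_prop) (by fun_prop)]
    conv_lhs => rw [← Measure.map_id (μ := M)]
    congr 1
    ext x i
    obtain rfl : i = 0 := by omega
    rfl
  | succ n ih =>
    set init : (Fin (n + 2) → ℝ) → Fin (n + 1) → ℝ := fun x i => x i.castSucc with hinit
    have him : Measurable init := by fun_prop
    have : IsProbabilityMeasure (M.map init) := Measure.isProbabilityMeasure_map him.aemeasurable
    have hinitlaw : M.map init = chainLaw μ n (fun i => K i.castSucc) := by
      refine ih _ _ ?_ ?_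
      · rw [Measure.map_map (by fun_prop) him, ← h0]; rfl
      · intro i g hg hgi h hh
        rw [lintegral_map (measurable_mul_eval hg hh _) him,
          lintegral_map (measurable_mul_eval hg hh.lintegral_kernel _) him]
        refine hM i.castSucc (g ∘ init) (hg.comp him) ?_ h hh
        intro x x' hxx
        exact hgi fun k hk => hxx k.castSucc hk
    have hpair : M.map (fun x => (init x, x (Fin.last (n + 1)))) =
        chainLaw μ n (fun i => K i.castSucc) ⊗ₘ
          (K (Fin.last n)).comap (fun x : Fin (n + 1) → ℝ => x (Fin.last n))
          (measurable_pi_apply _) := by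
      have hpm : Measurable (fun x : Fin (n + 2) → ℝ => (init x, x (Fin.last (n + 1)))) :=
        him.prodMk (measurable_pi_apply _)
      have := Measure.isProbabilityMeasure_map (μ := M) hpm.aemeasurable
      have := isProbabilityMeasure_chainLaw μ n (fun i => K i.castSucc)
      refine Measure.ext_prod fun {s t} hs ht => ?_
      rw [Measure.map_apply hpm (hs.prod ht), Measure.compProd_apply_prod hs ht, ← hinitlaw,
        ← lintegral_indicator hs, lintegral_map ((Kernel.measurable_coe _ ht).indicator hs) him]
      have := hM (Fin.last n) ((s.indicator 1) ∘ init) ((measurable_one.indicator hs).comp him)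
        (fun x x' hxx => by
          have : init x = init x' := funext fun k => hxx k.castSucc (Fin.le_last k)
          simp [this]) (t.indicator 1) (measurable_one.indicator ht)
      simp only [lintegral_indicator_one ht] at this
      have h1 : (fun x : Fin (n + 2) → ℝ => (s.indicator 1 ∘ init) x *
          t.indicator (1 : ℝ → ℝ≥0∞) (x (Fin.last n).succ)) =
          ((fun x => (init x, x (Fin.last (n + 1)))) ⁻¹' s ×ˢ t).indicator 1 := by
        ext x
        by_cases h1 : init x ∈ s <;> by_cases h2 : x (Fin.last (n + 1)) ∈ t <;>
          simp [indicator, h1, h2]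
      rw [h1, lintegral_indicator_one (hpm (hs.prod ht))] at this
      rw [this]
      refine lintegral_congr fun x => ?_
      by_cases h1 : init x ∈ s <;> simp [indicator, h1]
      rfl
    rw [chainLaw, ← hpair, Measure.map_map (measurable_snoc_prod n) (by fun_prop)]
    conv_lhs => rw [← Measure.map_id (μ := M)]
    congr 1
    ext x i
    refine Fin.lastCases ?_ (fun j => ?_) i <;> simp [init]

theorem map_chainLaw_zero (μ : Measure ℝ) [IsProbabilityMeasure μ] (n : ℕ)
    (K : Fin n → Kernel ℝ ℝ) [∀ i, IsMarkovKernel (K i)] :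
    (chainLaw μ n K).map (fun x => x 0) = μ := by
  induction n with
  | zero =>
    rw [chainLaw, Measure.map_map (by fun_prop) (by fun_prop)]
    exact Measure.map_id
  | succ n ih =>
    ext s hs
    conv_rhs => rw [← ih (fun i => K i.castSucc)]
    rw [Measure.map_apply (by fun_prop) hs, Measure.map_apply (by fun_prop) hs,
      ← lintegral_indicator_one (hs.preimage (measurable_pi_apply _)),
      ← lintegral_indicator_one (hs.preimage (measurable_pi_apply _)),
      lintegral_chainLaw_succ _ _ _
        (measurable_one.indicator (hs.preimage (measurable_pi_apply _)))]
    refine lintegral_congr fun x => ?_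
    have : ∀ y : ℝ, ((fun x : Fin (n + 2) → ℝ => x 0) ⁻¹' s).indicator
        (1 : (Fin (n + 2) → ℝ) → ℝ≥0∞)
        (Fin.snoc x y : Fin (n + 2) → ℝ) =
          ((fun x : Fin (n + 1) → ℝ => x 0) ⁻¹' s).indicator 1 x := by
      intro y
      have h0 : (Fin.snoc x y : Fin (n + 2) → ℝ) 0 = x 0 := by
        rw [← Fin.castSucc_zero, Fin.snoc_castSucc]
      exact congrArg (s.indicator (1 : ℝ → ℝ≥0∞)) h0
    simp [this]

/-- Observing a chain at an increasing sequence of its times gives a chain. -/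
theorem map_chainLaw_comp {ι : Type*} [Preorder ι] {I : Set ι} {Q : ι → ι → Kernel ℝ ℝ}
    (hQ : IsTransitionSystem I Q) [∀ s t, IsMarkovKernel (Q s t)]
    (μ : Measure ℝ) [IsProbabilityMeasure μ] {n m : ℕ} (U : Fin (n + 1) → ι) (hU : Monotone U)
    (hUI : ∀ i, U i ∈ I) (k : Fin (m + 1) → Fin (n + 1)) (hk : Monotone k) (hk0 : k 0 = 0) :
    (chainLaw μ n (fun i => Q (U i.castSucc) (U i.succ))).map (fun x i => x (k i)) =
      chainLaw μ m (fun i => Q (U (k i.castSucc)) (U (k i.succ))) := by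
  have := isProbabilityMeasure_chainLaw μ n (fun i => Q (U i.castSucc) (U i.succ))
  have hm : Measurable (fun (x : Fin (n + 1) → ℝ) i => x (k i)) := by fun_prop
  have := Measure.isProbabilityMeasure_map
    (μ := chainLaw μ n (fun i => Q (U i.castSucc) (U i.succ))) hm.aemeasurable
  refine eq_chainLaw μ _ _ ?_ ?_
  · rw [Measure.map_map (by fun_prop) hm]
    conv_rhs => rw [← map_chainLaw_zero μ n (fun i => Q (U i.castSucc) (U i.succ))]
    congr 1
    ext x
    simp [hk0]
  · intro i g hg hgi h hh
    rw [lintegral_map (measurable_mul_eval hg hh _) hm,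
      lintegral_map (measurable_mul_eval hg hh.lintegral_kernel _) hm]
    refine lintegral_chainLaw_mul hQ μ U hU hUI (hk (Fin.castSucc_le_succ i)) (hg.comp hm) ?_ hh
    intro x x' hxx
    exact hgi fun l hl => hxx (k l) (hk hl)

/-- The chain does not move between two times with the same label. -/
theorem chainLaw_ae_eq {ι : Type*} [Preorder ι] {I : Set ι} {Q : ι → ι → Kernel ℝ ℝ}
    (hQ : IsTransitionSystem I Q) [∀ s t, IsMarkovKernel (Q s t)]
    (μ : Measure ℝ) [IsProbabilityMeasure μ] {n : ℕ} (U : Fin (n + 1) → ι) (hU : Monotone U)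
    (hUI : ∀ i, U i ∈ I) {i j : Fin (n + 1)} (hij : i ≤ j) (h : U i = U j) :
    ∀ᵐ x ∂chainLaw μ n (fun i => Q (U i.castSucc) (U i.succ)), x j = x i := by
  set L := chainLaw μ n (fun i => Q (U i.castSucc) (U i.succ)) with hL
  have : IsProbabilityMeasure L := isProbabilityMeasure_chainLaw μ n _
  have hm1 : Measurable (fun x : Fin (n + 1) → ℝ => (x i, x j)) := by fun_prop
  have hm2 : Measurable (fun x : Fin (n + 1) → ℝ => (x i, x i)) := by fun_prop
  have hlaw : L.map (fun x => (x i, x j)) = L.map (fun x => (x i, x i)) := by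
    have := Measure.isProbabilityMeasure_map (μ := L) hm1.aemeasurable
    refine Measure.ext_prod fun {s t} hs ht => ?_
    have key := lintegral_chainLaw_mul hQ μ U hU hUI hij
      (g := fun x => s.indicator 1 (x i))
      ((measurable_one.indicator hs).comp (measurable_pi_apply i))
      (fun x x' hxx => by
        have : x i = x' i := hxx i self_mem_Iic
        simp only [this])
      (measurable_one.indicator ht (f := (1 : ℝ → ℝ≥0∞)))
    rw [← h, hQ.refl _ (hUI i)] at key
    simp only [Kernel.id_apply, lintegral_dirac' _ (measurable_one.indicator ht)] at key
    rw [Measure.map_apply hm1 (hs.prod ht), Measure.map_apply hm2 (hs.prod ht),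
      ← lintegral_indicator_one (hm1 (hs.prod ht)), ← lintegral_indicator_one (hm2 (hs.prod ht))]
    convert key using 2 <;>
    · ext x
      simp only [indicator, mem_preimage, mem_prod, Pi.one_apply]
      split_ifs <;> simp_all
  have hdiag : MeasurableSet {p : ℝ × ℝ | p.2 = p.1} :=
    measurableSet_eq_fun measurable_snd measurable_fst
  have h2 : ∀ᵐ p ∂L.map (fun x => (x i, x i)), p.2 = p.1 :=
    (ae_map_iff hm2.aemeasurable hdiag).2 (ae_of_all _ fun _ => rfl)
  rw [← hlaw] at h2
  exact (ae_map_iff hm1.aemeasurable hdiag).1 h2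

/-! ### Point measures and increments along a consistent ordering -/

section

variable {T : Type*}

/-- The mass of `B` under the finite signed point measure `∑ p, c p • δ_p`. -/
def pointMass (c : T →₀ ℝ) (B : Set T) : ℝ := ∑ p ∈ c.support, c p * B.indicator 1 p

theorem pointMass_eq_linearCombination (c : T →₀ ℝ) (B : Set T) :
    pointMass c B = Finsupp.linearCombination ℝ (B.indicator (1 : T → ℝ)) c := by
  simp [pointMass, Finsupp.linearCombination_apply, Finsupp.sum]

theorem pointMass_add (c d : T →₀ ℝ) (B : Set T) :
    pointMass (c + d) B = pointMass c B + pointMass d B := by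
  simp only [pointMass_eq_linearCombination, map_add]

theorem pointMass_single (p : T) (r : ℝ) (B : Set T) :
    pointMass (Finsupp.single p r) B = r * B.indicator 1 p := by
  simp [pointMass_eq_linearCombination]

@[simp] theorem pointMass_empty (c : T →₀ ℝ) : pointMass c ∅ = 0 := by
  simp [pointMass]

theorem pointMass_diff (c : T →₀ ℝ) (A B : Set T) :
    pointMass c (A \ B) = pointMass c A - pointMass c (A ∩ B) := by
  simp only [pointMass, ← Finset.sum_sub_distrib]
  refine Finset.sum_congr rfl fun p _ => ?_
  by_cases h1 : p ∈ A <;> by_cases h2 : p ∈ B <;> simp [h1, h2]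

theorem pointMass_sUnion (c : T →₀ ℝ) (F : Finset (Set T)) :
    pointMass c (⋃₀ (F : Set (Set T))) = inclExcl (pointMass c) F := by
  simp only [pointMass, inclExcl, Finset.mul_sum]
  rw [Finset.sum_comm]
  refine Finset.sum_congr rfl fun p _ => ?_
  have := Finset.indicator_biUnion_eq_sum_powerset F id (1 : T → ℝ) p
  have hU : (⋃ i ∈ F, id i) = ⋃₀ (F : Set (Set T)) := by simp [sUnion_eq_biUnion]
  rw [hU] at this
  rw [this, Finset.mul_sum]
  refine Finset.sum_congr rfl fun G _ => ?_
  have hI : (⋂ i ∈ G, id i) = ⋂₀ (G : Set (Set T)) := by simp [sInter_eq_biInter]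
  rw [hI]
  simp only [zsmul_eq_mul]
  push_cast
  ring

theorem inclExcl_congr {x y : Set T → ℝ} {F : Finset (Set T)}
    (h : ∀ G ⊆ F, G.Nonempty → x (⋂₀ (G : Set (Set T))) = y (⋂₀ (G : Set (Set T)))) :
    inclExcl x F = inclExcl y F := by
  refine Finset.sum_congr rfl fun G hG => ?_
  rw [Finset.mem_filter, Finset.mem_powerset] at hG
  rw [h G hG.1 hG.2]

/-- A function on an increasing sequence of sets, constant where the sequence is, is the restriction
of a point measure: put its jumps on points of the successive differences. -/
theorem exists_pointMass_eq {n : ℕ} (U : Fin (n + 1) → Set T) (hU : Monotone U)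
    (h0 : (U 0).Nonempty) (x : Fin (n + 1) → ℝ)
    (hx : ∀ i : Fin n, U i.castSucc = U i.succ → x i.succ = x i.castSucc) :
    ∃ c : T →₀ ℝ, (∀ i, pointMass c (U i) = x i) ∧
      ∀ B, U (Fin.last n) ⊆ B → pointMass c B = x (Fin.last n) := by
  induction n with
  | zero =>
    obtain ⟨p, hp⟩ := h0
    have : ∀ B, U 0 ⊆ B → pointMass (Finsupp.single p (x 0)) B = x 0 := fun B hB => by
      simp [pointMass_single, hB hp]
    refine ⟨Finsupp.single p (x 0), fun i => ?_, this⟩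
    obtain rfl : i = 0 := by omega
    exact this _ subset_rfl
  | succ n ih =>
    obtain ⟨c, hc, hcB⟩ := ih (fun i => U i.castSucc) (fun i j h => hU h) h0
      (fun i => x i.castSucc) (fun i h => hx i.castSucc h)
    by_cases heq : U (Fin.last n).castSucc = U (Fin.last n).succ
    · have hB : ∀ B, U (Fin.last (n + 1)) ⊆ B → pointMass c B = x (Fin.last (n + 1)) :=
        fun B hB => (hcB B (heq.trans_subset hB)).trans (hx _ heq).symm
      refine ⟨c, fun i => ?_, hB⟩
      refine Fin.lastCases ?_ (fun j => ?_) i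
      · exact hB _ subset_rfl
      · exact hc j
    · obtain ⟨p, hp, hp'⟩ : ∃ p ∈ U (Fin.last n).succ, p ∉ U (Fin.last n).castSucc := by
        by_contra! h
        exact heq (subset_antisymm (hU (Fin.castSucc_le_succ _)) h)
      have hB : ∀ B, U (Fin.last (n + 1)) ⊆ B →
          pointMass (c + Finsupp.single p (x (Fin.last n).succ - x (Fin.last n).castSucc)) B =
            x (Fin.last (n + 1)) := by
        intro B hB
        rw [pointMass_add, pointMass_single,
          hcB B ((hU (Fin.castSucc_le_succ (Fin.last n))).trans hB)]
        have : p ∈ B := hB hp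
        simp [this]
      refine ⟨_, fun i => ?_, hB⟩
      refine Fin.lastCases ?_ (fun j => ?_) i
      · exact hB _ subset_rfl
      · rw [pointMass_add, pointMass_single, hc j]
        have : p ∉ U j.castSucc := fun h => hp' (hU (Fin.le_last j) h)
        simp [this]

/-- The union `A 0 ∪ … ∪ A i`. -/
def initialUnion {n : ℕ} (A : Fin (n + 1) → Set T) (i : Fin (n + 1)) : Set T :=
  ⋃ j, ⋃ (_ : j ≤ i), A j

theorem mem_initialUnion {n : ℕ} {A : Fin (n + 1) → Set T} {i : Fin (n + 1)} {p : T} :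
    p ∈ initialUnion A i ↔ ∃ j ≤ i, p ∈ A j := by
  simp [initialUnion]

theorem monotone_initialUnion {n : ℕ} (A : Fin (n + 1) → Set T) : Monotone (initialUnion A) :=
  fun i j hij p hp => by
    obtain ⟨k, hk, hp⟩ := mem_initialUnion.1 hp
    exact mem_initialUnion.2 ⟨k, hk.trans hij, hp⟩

@[simp] theorem initialUnion_zero {n : ℕ} (A : Fin (n + 1) → Set T) :
    initialUnion A 0 = A 0 := by
  ext p
  simp [mem_initialUnion]

/-- The value at `D` of the process whose values at the successive unions
`A 1 ∪ … ∪ A i` are `x i`: the sum of its increments over the left neighbourhoods of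
the sets `A i ⊆ D`. -/
def valueOf {n : ℕ} (A : Fin (n + 1) → Set T) (x : Fin (n + 1) → ℝ) (D : Set T) : ℝ :=
  open Classical in ∑ i, if i ≠ 0 ∧ A i ⊆ D then increment x i else 0

theorem measurable_increment {n : ℕ} (i : Fin (n + 1)) :
    Measurable (fun x : Fin (n + 1) → ℝ => increment x i) := by
  unfold increment
  split_ifs <;> fun_prop

theorem measurable_valueOf {n : ℕ} (A : Fin (n + 1) → Set T) :
    Measurable (fun (x : Fin (n + 1) → ℝ) D => valueOf A x D) := by
  refine measurable_pi_iff.2 fun D => ?_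
  unfold valueOf
  refine Finset.measurable_sum _ fun i _ => ?_
  split_ifs
  · exact measurable_increment i
  · exact measurable_const

theorem measurable_indicator_valueOf (𝒜 : Set (Set T)) {n : ℕ} (A : Fin (n + 1) → Set T) :
    Measurable fun x : Fin (n + 1) → ℝ => 𝒜.indicator (valueOf A x) := by
  refine measurable_pi_iff.2 fun D => ?_
  by_cases hD : D ∈ 𝒜
  · simp only [indicator_of_mem hD]
    exact (measurable_pi_apply D).comp (measurable_valueOf A)
  · simp only [indicator_of_notMem hD, measurable_const]

theorem coe_one_of_pos {n : ℕ} (hn : 0 < n) : ((1 : Fin (n + 1)) : ℕ) = 1 := by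
  obtain ⟨m, rfl⟩ := Nat.exists_eq_succ_of_ne_zero hn.ne'
  rfl

theorem one_ne_zero_of_pos {n : ℕ} (hn : 0 < n) : (1 : Fin (n + 1)) ≠ 0 := fun h => by
  have := congrArg Fin.val h
  rw [coe_one_of_pos hn] at this
  simp at this

theorem coe_sub_one_of_ne_zero {n : ℕ} {i : Fin (n + 1)} (hi : i ≠ 0) :
    ((i - 1 : Fin (n + 1)) : ℕ) = i - 1 := by
  rw [Fin.coe_sub_one, if_neg hi]

/-- The value at `D` depends only on the chain up to the last set of the ordering inside `D`. -/
theorem valueOf_congr {n : ℕ} {A : Fin (n + 1) → Set T} {D : Set T} {k : Fin (n + 1)}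
    (hk : ∀ j, j ≠ 0 → A j ⊆ D → j ≤ k) {x y : Fin (n + 1) → ℝ} (h : ∀ i ≤ k, x i = y i) :
    valueOf A x D = valueOf A y D := by
  refine Finset.sum_congr rfl fun i _ => ?_
  split_ifs with hi
  · have hik := hk i hi.1 hi.2
    have : i - 1 ≤ k := le_trans (by
      rw [Fin.le_def, coe_sub_one_of_ne_zero hi.1]; omega) hik
    simp only [increment, h i hik, h (i - 1) this]
  · rfl

namespace IsConsistentOrdering

variable {𝒜 : Set (Set T)} {n : ℕ} {A : Fin (n + 1) → Set T}

theorem zero_subset (hA : IsConsistentOrdering 𝒜 A) (i : Fin (n + 1)) : A 0 ⊆ A i := by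
  by_cases hi : i = 0
  · rw [hi]
  · rw [hA.zero]
    exact sInter_subset_of_mem ⟨hA.mem i hi, (hA.nonempty i hi).ne_empty⟩

theorem le_of_subset (hA : IsConsistentOrdering 𝒜 A) {i j : Fin (n + 1)} (hi : i ≠ 0)
    (hj : j ≠ 0) (h : A i ⊆ A j) : i ≤ j := by
  by_cases heq : A i = A j
  · exact (hA.injective i j hi hj heq).le
  · exact (hA.order i j hi hj (h.ssubset_of_ne heq)).le

/-- If `i` is the first index with `p ∈ A i`, then every set of the ordering that
contains `p` contains `A i`. -/
theorem subset_of_first (hA : IsConsistentOrdering 𝒜 A) {i l : Fin (n + 1)} (hi : i ≠ 0)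
    (hl : l ≠ 0) {p : T} (hpi : p ∈ A i) (hfirst : ∀ j, j ≠ 0 → j < i → p ∉ A j)
    (hpl : p ∈ A l) : A i ⊆ A l := by
  obtain ⟨k, hk, hkeq⟩ := hA.inter i l hi hl
  have hki : k ≤ i := hA.le_of_subset hk hi (hkeq.trans_subset inter_subset_left)
  have : k = i := hki.eq_of_not_lt fun hlt => hfirst k hk hlt (hkeq ▸ ⟨hpi, hpl⟩)
  subst this
  rw [hkeq]
  exact inter_subset_right

/-- The increments of a point measure along an ordering are its masses on the left
neighbourhoods. -/
theorem increment_pointMass (hA : IsConsistentOrdering 𝒜 A) (c : T →₀ ℝ) {i : Fin (n + 1)}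
    (hi : i ≠ 0) :
    increment (fun j => pointMass c (initialUnion A j)) i =
      pointMass c {p | p ∈ A i ∧ ∀ j, j ≠ 0 → j < i → p ∉ A j} := by
  unfold increment
  have hi0 : (i : ℕ) ≠ 0 := fun h => hi (Fin.ext h)
  split_ifs with h
  · change pointMass c (initialUnion A i) = _
    congr 1
    ext p
    simp only [mem_initialUnion, mem_ofPred_eq]
    constructor
    · rintro ⟨j, hj, hp⟩
      refine ⟨?_, fun j hj0 hji => ?_⟩
      · by_cases hj0 : j = 0
        · exact hA.zero_subset i (hj0 ▸ hp)
        · have : (j : ℕ) ≠ 0 := fun h => hj0 (Fin.ext h)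
          have : j = i := by rw [Fin.le_def] at hj; exact Fin.ext (by omega)
          exact this ▸ hp
      · have : (j : ℕ) ≠ 0 := fun h => hj0 (Fin.ext h)
        rw [Fin.lt_def] at hji
        omega
    · exact fun hp => ⟨i, le_rfl, hp.1⟩
  · have hval := coe_sub_one_of_ne_zero hi
    have hle : i - 1 ≤ i := by rw [Fin.le_def, hval]; omega
    have hset : {p | p ∈ A i ∧ ∀ j, j ≠ 0 → j < i → p ∉ A j} =
        initialUnion A i \ initialUnion A (i - 1) := by
      ext p
      simp only [mem_ofPred_eq, Set.mem_sdiff, mem_initialUnion]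
      constructor
      · rintro ⟨hp, hp'⟩
        refine ⟨⟨i, le_rfl, hp⟩, ?_⟩
        rintro ⟨j, hj, hpj⟩
        rw [Fin.le_def, hval] at hj
        by_cases hj0 : j = 0
        · refine hp' (i - 1) (fun h0 => ?_) (by rw [Fin.lt_def, hval]; omega)
            (hA.zero_subset _ (hj0 ▸ hpj))
          rw [h0] at hval
          simp at hval
          omega
        · exact hp' j hj0 (by rw [Fin.lt_def]; omega) hpj
      · rintro ⟨⟨j, hj, hpj⟩, hp'⟩
        have hji : j = i := by
          by_contra hne
          exact hp' ⟨j, by rw [Fin.le_def, hval]; rw [Fin.le_def] at hj; omega, hpj⟩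
        refine ⟨hji ▸ hpj, fun j _ hj hpj => hp' ⟨j, ?_, hpj⟩⟩
        rw [Fin.le_def, hval]
        rw [Fin.lt_def] at hj
        omega
    rw [hset, pointMass_diff, inter_eq_right.2 (monotone_initialUnion A hle)]

/-- The left neighbourhoods of the sets `A i ⊆ D` form a partition of `D`. -/
theorem valueOf_pointMass (hA : IsConsistentOrdering 𝒜 A) (c : T →₀ ℝ) {l : Fin (n + 1)}
    (hl : l ≠ 0) :
    valueOf A (fun j => pointMass c (initialUnion A j)) (A l) = pointMass c (A l) := by
  classical
  have h1 : valueOf A (fun j => pointMass c (initialUnion A j)) (A l) =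
      ∑ i, ∑ p ∈ c.support, if i ≠ 0 ∧ A i ⊆ A l then
        c p * {p | p ∈ A i ∧ ∀ j, j ≠ 0 → j < i → p ∉ A j}.indicator 1 p else 0 := by
    refine Finset.sum_congr rfl fun i _ => ?_
    by_cases hi : i ≠ 0 ∧ A i ⊆ A l
    · rw [if_pos hi, hA.increment_pointMass c hi.1, pointMass]
      exact Finset.sum_congr rfl fun p _ => (if_pos hi).symm
    · simp only [if_neg hi, Finset.sum_const_zero]
  rw [h1, Finset.sum_comm]
  refine Finset.sum_congr rfl fun p _ => ?_
  by_cases hp : p ∈ A l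
  · have hne : (Finset.univ.filter fun i : Fin (n + 1) => i ≠ 0 ∧ p ∈ A i).Nonempty :=
      ⟨l, by simp [hl, hp]⟩
    obtain ⟨i, hi, hmin⟩ := Finset.exists_minimal hne
    simp only [Finset.mem_filter, Finset.mem_univ, true_and] at hi hmin
    have hfirst : ∀ j, j ≠ 0 → j < i → p ∉ A j := fun j hj hji hpj =>
      absurd (hmin ⟨hj, hpj⟩ hji.le) (not_le.2 hji)
    have hil := hA.subset_of_first hi.1 hl hi.2 hfirst hp
    rw [Finset.sum_eq_single i]
    · have hpC : p ∈ {p | p ∈ A i ∧ ∀ j, j ≠ 0 → j < i → p ∉ A j} := ⟨hi.2, hfirst⟩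
      rw [if_pos ⟨hi.1, hil⟩, indicator_of_mem hpC, indicator_of_mem hp]
    · intro j _ hji
      split_ifs with hj
      · rw [indicator_of_notMem, mul_zero]
        rintro ⟨hpj, hfj⟩
        rcases lt_or_gt_of_ne hji with h | h
        · exact hfirst j hj.1 h hpj
        · exact hfj i hi.1 h hi.2
      · rfl
    · simp
  · rw [indicator_of_notMem hp, mul_zero]
    refine Finset.sum_eq_zero fun i _ => ?_
    split_ifs with hi
    · rw [indicator_of_notMem, mul_zero]
      exact fun h => hp (hi.2 h.1)
    · rfl

theorem valueOf_empty (hA : IsConsistentOrdering 𝒜 A) (x : Fin (n + 1) → ℝ) :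
    valueOf A x ∅ = 0 := by
  refine Finset.sum_eq_zero fun i _ => if_neg ?_
  rintro ⟨hi, h⟩
  exact (hA.nonempty i hi).ne_empty (subset_empty_iff.1 h)

theorem valueOf_eq_pointMass (hA : IsConsistentOrdering 𝒜 A)
    {x : Fin (n + 1) → ℝ} {c : T →₀ ℝ} (hc : ∀ i, pointMass c (initialUnion A i) = x i)
    {D : Set T} (hD : D.Nonempty → ∃ i, i ≠ 0 ∧ A i = D) : valueOf A x D = pointMass c D := by
  rcases D.eq_empty_or_nonempty with rfl | hne
  · rw [hA.valueOf_empty, pointMass_empty]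
  · obtain ⟨i, hi, rfl⟩ := hD hne
    rw [← hA.valueOf_pointMass c hi]
    simp only [hc]

/-- The first set of a consistent ordering is contained in all its sets. -/
theorem one_subset (hA : IsConsistentOrdering 𝒜 A) {i : Fin (n + 1)} (hi : i ≠ 0) :
    A 1 ⊆ A i := by
  have h1 := one_ne_zero_of_pos hA.pos
  obtain ⟨k, hk, hkeq⟩ := hA.inter 1 i h1 hi
  have hk1 : k ≤ 1 := hA.le_of_subset hk h1 (hkeq.trans_subset inter_subset_left)
  have : k = 1 := by
    rw [Fin.le_def, coe_one_of_pos hA.pos] at hk1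
    have : (k : ℕ) ≠ 0 := fun h => hk (Fin.ext h)
    exact Fin.ext (by rw [coe_one_of_pos hA.pos]; omega)
  rw [← this, hkeq]
  exact inter_subset_right

/-- Two consistent orderings of the same semilattice differ by a permutation that fixes the first
set. -/
theorem exists_perm {n' : ℕ} {A' : Fin (n' + 1) → Set T} (hA : IsConsistentOrdering 𝒜 A)
    (hA' : IsConsistentOrdering 𝒜 A') (h : A '' {0}ᶜ = A' '' {0}ᶜ) :
    ∃ hn : n' = n, ∃ π : Equiv.Perm (Fin (n + 1)), π 0 = 0 ∧ π 1 = 1 ∧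
      ∀ i, A i = A' (Fin.cast (by rw [hn]) (π i)) := by
  have hinj : InjOn A {0}ᶜ := fun i hi j hj => hA.injective i j hi hj
  have hinj' : InjOn A' {0}ᶜ := fun i hi j hj => hA'.injective i j hi hj
  have hcard : n' = n := by
    have h1 := hinj.ncard_image
    have h2 := hinj'.ncard_image
    rw [h, h2, Set.ncard_compl, Set.ncard_compl] at h1
    simpa using h1
  subst hcard
  refine ⟨rfl, ?_⟩
  have hex : ∀ i : Fin (n' + 1), ∃ j, (i = 0 ↔ j = 0) ∧ A i = A' j := by
    intro i
    by_cases hi : i = 0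
    · exact ⟨0, by simp [hi], by rw [hi, hA.zero, hA'.zero]⟩
    · obtain ⟨j, hj, hij⟩ := h.subset (mem_image_of_mem A (show i ∈ ({0}ᶜ : Set _) from hi))
      exact ⟨j, by simp [hi, show j ≠ 0 from hj], hij.symm⟩
  choose σ hσ0 hσ using hex
  have hσinj : Function.Injective σ := by
    intro i j hij
    by_cases hi : i = 0
    · rw [hi, eq_comm]
      exact (hσ0 j).2 (hij ▸ (hσ0 i).1 hi)
    · have hj : j ≠ 0 := fun hj => hi ((hσ0 i).2 (hij ▸ (hσ0 j).1 hj))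
      exact hA.injective i j hi hj (by rw [hσ, hσ, hij])
  have h10 := one_ne_zero_of_pos hA.pos
  refine ⟨Equiv.ofBijective σ (Finite.injective_iff_bijective.1 hσinj), (hσ0 0).1 rfl, ?_, hσ⟩
  have hs0 : σ 1 ≠ 0 := fun h => h10 ((hσ0 1).2 h)
  refine hA'.injective _ _ hs0 h10 ?_
  change A' (σ 1) = A' 1
  refine subset_antisymm ?_ (hA'.one_subset hs0)
  obtain ⟨j, hj, hij⟩ := h.symm.subset (mem_image_of_mem A' (show 1 ∈ ({0}ᶜ : Set _) from h10))
  rw [← hσ, ← hij]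
  exact hA.one_subset hj

end IsConsistentOrdering

end

/-! ### Existence of consistent orderings -/

section

variable {T : Type*}

theorem minimalSet_subset {𝒜 : Set (Set T)} {A : Set T} (hA : A ∈ 𝒜) (hne : A.Nonempty) :
    minimalSet 𝒜 ⊆ A :=
  sInter_subset_of_mem ⟨hA, hne.ne_empty⟩

section MinimalSet

variable [TopologicalSpace T] {𝒜 : Set (Set T)}

theorem IsIndexingCollection.inter_mem (h𝒜 : IsIndexingCollection 𝒜) {A B : Set T} (hA : A ∈ 𝒜)
    (hB : B ∈ 𝒜) : A ∩ B ∈ 𝒜 := by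
  rw [← sInter_pair]
  exact h𝒜.sInter_mem _ (pair_subset hA hB)

theorem IsIndexingCollection.minimalSet_mem (h𝒜 : IsIndexingCollection 𝒜) : minimalSet 𝒜 ∈ 𝒜 :=
  h𝒜.sInter_mem _ sdiff_subset

theorem IsIndexingCollection.minimalSet_nonempty [CompactSpace T] [Nonempty T]
    (h𝒜 : IsIndexingCollection 𝒜) : (minimalSet 𝒜).Nonempty := by
  have : Nonempty ↥(𝒜 \ {∅}) := ⟨⟨univ, h𝒜.univ_mem, univ_nonempty.ne_empty⟩⟩
  rw [minimalSet, sInter_eq_iInter]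
  refine IsCompact.nonempty_iInter_of_directed_nonempty_isCompact_isClosed _ ?_ ?_ ?_ ?_
  · rintro ⟨A, hA, hA0⟩ ⟨B, hB, hB0⟩
    have := h𝒜.inter_nonempty A hA B hB (nonempty_iff_ne_empty.2 hA0) (nonempty_iff_ne_empty.2 hB0)
    exact ⟨⟨A ∩ B, h𝒜.inter_mem hA hB, this.ne_empty⟩, inter_subset_left, inter_subset_right⟩
  · exact fun A => nonempty_iff_ne_empty.2 A.2.2
  · exact fun A => (h𝒜.isClosed A A.2.1).isCompact
  · exact fun A => h𝒜.isClosed A A.2.1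

/-- Every finite subfamily of `𝒜` lies, up to the empty set, in a finite sub-semilattice of
non-empty sets that contains `∅'`. -/
theorem IsIndexingCollection.exists_semilattice [CompactSpace T] [Nonempty T]
    (h𝒜 : IsIndexingCollection 𝒜) (F : Finset (Set T)) (hF : (F : Set (Set T)) ⊆ 𝒜) :
    ∃ 𝒟 : Finset (Set T), (∀ D ∈ 𝒟, D ∈ 𝒜 ∧ D.Nonempty) ∧ (∀ D ∈ 𝒟, ∀ E ∈ 𝒟, D ∩ E ∈ 𝒟) ∧
      minimalSet 𝒜 ∈ 𝒟 ∧ ∀ D ∈ F, D.Nonempty → D ∈ 𝒟 := by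
  classical
  have hmem : ∀ G ⊆ insert (minimalSet 𝒜) F, ⋂₀ (G : Set (Set T)) ∈ 𝒜 := fun G hG =>
    h𝒜.sInter_mem _ fun D hD => by
      rcases Finset.mem_insert.1 (hG hD) with h | h
      · exact h ▸ h𝒜.minimalSet_mem
      · exact hF h
  refine ⟨((insert (minimalSet 𝒜) F).powerset.image
    fun G : Finset (Set T) => ⋂₀ (G : Set (Set T))).filter fun D => D.Nonempty, ?_, ?_, ?_, ?_⟩
  · intro D hD
    simp only [Finset.mem_filter, Finset.mem_image, Finset.mem_powerset] at hD
    obtain ⟨⟨G, hG, rfl⟩, hne⟩ := hD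
    exact ⟨hmem G hG, hne⟩
  · intro D hD E hE
    simp only [Finset.mem_filter, Finset.mem_image, Finset.mem_powerset] at hD hE ⊢
    obtain ⟨⟨G, hG, rfl⟩, hne⟩ := hD
    obtain ⟨⟨G', hG', rfl⟩, hne'⟩ := hE
    refine ⟨⟨G ∪ G', Finset.union_subset hG hG', ?_⟩,
      h𝒜.inter_nonempty _ (hmem G hG) _ (hmem G' hG') hne hne'⟩
    rw [Finset.coe_union, sInter_union]
  · simp only [Finset.mem_filter, Finset.mem_image, Finset.mem_powerset]
    exact ⟨⟨{minimalSet 𝒜}, by simp, by simp⟩, h𝒜.minimalSet_nonempty⟩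
  · intro D hD hne
    simp only [Finset.mem_filter, Finset.mem_image, Finset.mem_powerset]
    exact ⟨⟨{D}, by simp [hD], by simp⟩, hne⟩

end MinimalSet

/-- A finite semilattice has a consistent ordering along which a given monotone function `r`
increases. -/
theorem exists_ordering_monotone {𝒜 : Set (Set T)} (𝒟 : Finset (Set T))
    (h𝒟 : ∀ D ∈ 𝒟, D ∈ 𝒜 ∧ D.Nonempty) (hinter : ∀ D ∈ 𝒟, ∀ E ∈ 𝒟, D ∩ E ∈ 𝒟)
    (hne : 𝒟.Nonempty) (r : Set T → ℕ) (hr : Monotone r) :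
    ∃ (n : ℕ) (A : Fin (n + 1) → Set T), IsConsistentOrdering 𝒜 A ∧
      (∀ D, D ∈ 𝒟 ↔ ∃ i, i ≠ 0 ∧ A i = D) ∧
      ∀ i j, i ≠ 0 → i ≤ j → r (A i) ≤ r (A j) := by
  classical
  -- sort by `r`, and among equal values of `r` by the number of subsets in `𝒟`
  set m : Set T → ℕ := fun D => (𝒟.filter fun E => E ⊆ D).card with hm
  set key : Set T → ℕ := fun D => r D * (𝒟.card + 1) + m D with hkey
  have hm_le : ∀ D, m D < 𝒟.card + 1 := fun D => Nat.lt_succ_of_le (Finset.card_filter_le _ _)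
  have hkey_lt : ∀ D ∈ 𝒟, ∀ E ∈ 𝒟, D ⊂ E → key D < key E := by
    intro D _ E hE hDE
    have h1 : m D < m E := Finset.card_lt_card <| by
      refine (Finset.ssubset_iff_of_subset ?_).2 ⟨E, by simp [hE], by simp [hDE.2]⟩
      intro G hG
      simp only [Finset.mem_filter] at hG ⊢
      exact ⟨hG.1, hG.2.trans hDE.1⟩
    have h2 : r D * (𝒟.card + 1) ≤ r E * (𝒟.card + 1) := Nat.mul_le_mul_right _ (hr hDE.1)
    simp only [hkey]
    omega
  have hkey_r : ∀ D E, key D ≤ key E → r D ≤ r E := by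
    intro D E h
    by_contra! hlt
    have h1 := hm_le E
    have h2 : (r E + 1) * (𝒟.card + 1) ≤ r D * (𝒟.card + 1) := Nat.mul_le_mul_right _ hlt
    simp only [hkey] at h
    rw [add_mul] at h2
    omega
  set e := 𝒟.equivFin.symm with he
  set f : Fin 𝒟.card → ℕ := fun i => key (e i) with hf
  set σ := Tuple.sort f with hσ
  have hmono : Monotone (f ∘ σ) := Tuple.monotone_sort f
  set A : Fin (𝒟.card + 1) → Set T := Fin.cons (minimalSet 𝒜) fun i => (e (σ i) : Set T) with hA
  have hAs : ∀ i : Fin 𝒟.card, A i.succ = e (σ i) := fun i => rfl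
  have hA𝒟 : ∀ i, i ≠ 0 → A i ∈ 𝒟 := by
    intro i hi
    obtain ⟨i, rfl⟩ := Fin.exists_succ_eq.2 hi
    exact (e (σ i)).2
  have hsurj : ∀ D ∈ 𝒟, ∃ i, i ≠ 0 ∧ A i = D := fun D hD =>
    ⟨(σ.symm (e.symm ⟨D, hD⟩)).succ, Fin.succ_ne_zero _, by simp [hAs]⟩
  have hkeyA : ∀ i j, i ≠ 0 → i ≤ j → key (A i) ≤ key (A j) := by
    intro i j hi hij
    have hj : j ≠ 0 := fun h => hi (by rw [h] at hij; exact Fin.le_zero_iff.1 hij)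
    obtain ⟨i, rfl⟩ := Fin.exists_succ_eq.2 hi
    obtain ⟨j, rfl⟩ := Fin.exists_succ_eq.2 hj
    exact hmono (Fin.succ_le_succ_iff.1 hij)
  refine ⟨𝒟.card, A, ⟨hne.card_pos, rfl, fun i hi => (h𝒟 _ (hA𝒟 i hi)).1,
    fun i hi => (h𝒟 _ (hA𝒟 i hi)).2, ?_, ?_, ?_⟩, ?_, ?_⟩
  · intro i j hi hj hij
    obtain ⟨i, rfl⟩ := Fin.exists_succ_eq.2 hi
    obtain ⟨j, rfl⟩ := Fin.exists_succ_eq.2 hj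
    rw [hAs, hAs] at hij
    rw [σ.injective (e.injective (Subtype.ext hij))]
  · intro i j hi hj
    exact hsurj _ (hinter _ (hA𝒟 i hi) _ (hA𝒟 j hj))
  · intro i j hi hj hij
    by_contra! hle
    exact absurd (hkey_lt _ (hA𝒟 i hi) _ (hA𝒟 j hj) hij) (not_lt.2 (hkeyA j i hj hle))
  · intro D
    refine ⟨hsurj D, ?_⟩
    rintro ⟨i, hi, rfl⟩
    exact hA𝒟 i hi
  · exact fun i j hi hij => hkey_r _ _ (hkeyA i j hi hij)

/-- The index `k` cuts the ordering `A` at `B`: the sets `A 1, …, A k` are those contained in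
`B`, and their union is `B`. -/
structure IsCut {n : ℕ} (A : Fin (n + 1) → Set T) (B : Set T) (k : Fin (n + 1)) : Prop where
  subset_iff : ∀ j, j ≠ 0 → (A j ⊆ B ↔ j ≤ k)
  initialUnion_eq : initialUnion A k = B

/-- A finite semilattice has a consistent ordering that is cut at every set of a given finite
chain of unions of its members. -/
theorem exists_ordering_isCut {𝒜 : Set (Set T)} (𝒟 : Finset (Set T))
    (h𝒟 : ∀ D ∈ 𝒟, D ∈ 𝒜 ∧ D.Nonempty) (hinter : ∀ D ∈ 𝒟, ∀ E ∈ 𝒟, D ∩ E ∈ 𝒟)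
    (hmin : minimalSet 𝒜 ∈ 𝒟) {m : ℕ} (B : Fin m → Set T) (hB : Monotone B)
    (hBne : ∀ a, (B a).Nonempty) (hBu : ∀ a, ∀ p ∈ B a, ∃ D ∈ 𝒟, p ∈ D ∧ D ⊆ B a) :
    ∃ (n : ℕ) (A : Fin (n + 1) → Set T), IsConsistentOrdering 𝒜 A ∧
      (∀ D, D ∈ 𝒟 ↔ ∃ i, i ≠ 0 ∧ A i = D) ∧ ∀ a, ∃ k, IsCut A (B a) k := by
  classical
  set r : Set T → ℕ := fun D => (Finset.univ.filter fun a => ¬ D ⊆ B a).card with hr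
  have hrmono : Monotone r := fun D E hDE => Finset.card_le_card fun a ha => by
    simp only [Finset.mem_filter, Finset.mem_univ, true_and] at ha ⊢
    exact fun h => ha (Set.Subset.trans hDE h)
  have hrB : ∀ D a, D ⊆ B a ↔ r D ≤ a := by
    intro D a
    constructor
    · intro h
      have : (Finset.univ.filter fun a => ¬ D ⊆ B a) ⊆ Finset.Iio a := by
        intro b hb
        simp only [Finset.mem_filter, Finset.mem_univ, true_and] at hb
        rw [Finset.mem_Iio]
        by_contra! hab
        exact hb (h.trans (hB hab))
      simpa using Finset.card_le_card this
    · intro h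
      by_contra hD
      have : Finset.Iic a ⊆ (Finset.univ.filter fun a => ¬ D ⊆ B a) := by
        intro b hb
        simp only [Finset.mem_filter, Finset.mem_univ, true_and]
        exact fun hDb => hD (hDb.trans (hB (Finset.mem_Iic.1 hb)))
      have := Finset.card_le_card this
      rw [Fin.card_Iic] at this
      simp only [hr] at h
      omega
  obtain ⟨n, A, hA, hA𝒟, hAr⟩ := exists_ordering_monotone 𝒟 h𝒟 hinter ⟨_, hmin⟩ r hrmono
  refine ⟨n, A, hA, hA𝒟, fun a => ?_⟩
  have hA0 : A 0 ⊆ B a := by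
    obtain ⟨p, hp⟩ := hBne a
    obtain ⟨D, hD, -, hDB⟩ := hBu a p hp
    rw [hA.zero]
    exact (minimalSet_subset (h𝒟 D hD).1 (h𝒟 D hD).2).trans hDB
  obtain ⟨k, hk, hmax⟩ := Finset.exists_maximal (s := Finset.univ.filter fun j => A j ⊆ B a)
    ⟨0, by simp [hA0]⟩
  simp only [Finset.mem_filter, Finset.mem_univ, true_and] at hk hmax
  have hcut : ∀ j, j ≠ 0 → (A j ⊆ B a ↔ j ≤ k) := by
    intro j hj
    constructor
    · intro h
      by_contra! hlt
      exact absurd (hmax h hlt.le) (not_le.2 hlt)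
    · intro h
      rw [hrB] at hk ⊢
      exact (hAr j k hj h).trans hk
  refine ⟨k, hcut, ?_⟩
  ext p
  rw [mem_initialUnion]
  constructor
  · rintro ⟨j, hj, hp⟩
    by_cases hj0 : j = 0
    · exact hA0 (hj0 ▸ hp)
    · exact (hcut j hj0).2 hj hp
  · intro hp
    obtain ⟨D, hD, hpD, hDB⟩ := hBu a p hp
    obtain ⟨j, hj, rfl⟩ := (hA𝒟 D).1 hD
    exact ⟨j, (hcut j hj).1 hDB, hpD⟩

theorem IsCut.le {n : ℕ} {A : Fin (n + 1) → Set T} {B B' : Set T} {k k' : Fin (n + 1)}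
    (h : IsCut A B k) (h' : IsCut A B' k') (hBB' : B ⊆ B') : k ≤ k' := by
  by_cases hk : k = 0
  · rw [hk]; exact Fin.zero_le _
  · exact (h'.subset_iff k hk).1 (((h.subset_iff k hk).2 le_rfl).trans hBB')

end

/-! ### The set-indexed transition system of a family of flows -/

section

variable {T : Type*}

theorem minimalSet_subset_of_mem_finiteUnions {𝒜 : Set (Set T)} {B : Set T}
    (hB : B ∈ finiteUnions 𝒜) (hne : B.Nonempty) : minimalSet 𝒜 ⊆ B := by
  obtain ⟨F, hF, rfl⟩ := hB
  obtain ⟨p, D, hD, hp⟩ := hne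
  exact (minimalSet_subset (hF hD) ⟨p, hp⟩).trans (subset_sUnion_of_mem hD)

theorem mem_finiteUnions {𝒜 : Set (Set T)} {A : Set T} (hA : A ∈ 𝒜) : A ∈ finiteUnions 𝒜 :=
  ⟨{A}, by simpa using hA, by simp⟩

/-- The flow of `p.1 ∈ S` leads from `B` at time `p.2.1` to `B'` at time `p.2.2`. -/
def LeadsTo (S : Set (Path T)) (B B' : Set T) (p : Path T × ℝ × ℝ) : Prop :=
  p.1 ∈ S ∧ p.2.1 ∈ Icc 0 p.1.a ∧ p.2.2 ∈ Icc 0 p.1.a ∧ p.2.1 ≤ p.2.2 ∧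
    p.1.toFun p.2.1 = B ∧ p.1.toFun p.2.2 = B'

open Classical in
/-- The transition probability from `B` to `B'` of any flow of `S` that leads from `B`
to `B'`, the identity if there is none. -/
def flowKernel (S : Set (Path T)) (Qf : Path T → ℝ → ℝ → Kernel ℝ ℝ) (B B' : Set T) :
    Kernel ℝ ℝ :=
  if h : ∃ p, LeadsTo S B B' p then Qf h.choose.1 h.choose.2.1 h.choose.2.2 else Kernel.id

open Classical in
/-- The set-indexed transition system of the process. No flow visits `∅`; from there the process
jumps to `∅'` with law `μ`. -/
def setKernel (𝒜 : Set (Set T)) (μ : Measure ℝ) (S : Set (Path T))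
    (Qf : Path T → ℝ → ℝ → Kernel ℝ ℝ) (B B' : Set T) : Kernel ℝ ℝ :=
  if B = ∅ ∧ B' ≠ ∅ then flowKernel S Qf (minimalSet 𝒜) B' ∘ₖ Kernel.const ℝ μ
  else flowKernel S Qf B B'

theorem setKernel_of_nonempty {𝒜 : Set (Set T)} {μ : Measure ℝ} {S : Set (Path T)}
    {Qf : Path T → ℝ → ℝ → Kernel ℝ ℝ} {B : Set T} (hB : B.Nonempty) (B' : Set T) :
    setKernel 𝒜 μ S Qf B B' = flowKernel S Qf B B' :=
  if_neg fun h => hB.ne_empty h.1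

variable [TopologicalSpace T]

theorem initialUnion_mem_finiteUnions {𝒜 : Set (Set T)} (h𝒜 : IsIndexingCollection 𝒜) {n : ℕ}
    {A : Fin (n + 1) → Set T} (hA : IsConsistentOrdering 𝒜 A) (i : Fin (n + 1)) :
    initialUnion A i ∈ finiteUnions 𝒜 := by
  classical
  refine ⟨(Finset.Iic i).image A, ?_, ?_⟩
  · intro D hD
    simp only [Finset.coe_image, mem_image, Finset.coe_Iic] at hD
    obtain ⟨j, -, rfl⟩ := hD
    by_cases hj : j = 0
    · rw [hj, hA.zero]
      exact h𝒜.minimalSet_mem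
    · exact hA.mem j hj
  · ext p
    simp [mem_initialUnion]

/-- Given finitely many sets of `𝒜` and a finite chain in `𝒜(u)`, there is a consistent ordering
through these sets that is cut at each set of the chain. -/
theorem IsIndexingCollection.exists_ordering_isCut [CompactSpace T] [Nonempty T]
    {𝒜 : Set (Set T)} (h𝒜 : IsIndexingCollection 𝒜) (J : Finset (Set T))
    (hJ : (J : Set (Set T)) ⊆ 𝒜) {m : ℕ} (B : Fin m → Set T) (hB : Monotone B)
    (hBu : ∀ a, B a ∈ finiteUnions 𝒜) (hBne : ∀ a, (B a).Nonempty) :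
    ∃ (n : ℕ) (A : Fin (n + 1) → Set T), IsConsistentOrdering 𝒜 A ∧
      (∀ D ∈ J, D.Nonempty → ∃ i, i ≠ 0 ∧ A i = D) ∧ ∀ a, ∃ k, IsCut A (B a) k := by
  classical
  choose G hG hBG using hBu
  obtain ⟨𝒟, h𝒟, hinter, hmin, hsub⟩ := h𝒜.exists_semilattice (J ∪ Finset.univ.biUnion G) (by
    intro D hD
    rw [Finset.mem_coe, Finset.mem_union, Finset.mem_biUnion] at hD
    rcases hD with hD | ⟨a, -, hD⟩
    · exact hJ hD
    · exact hG a hD)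
  obtain ⟨n, A, hA, hA𝒟, hcut⟩ := SetIndexed.exists_ordering_isCut 𝒟 h𝒟 hinter hmin B hB hBne
    (by
      intro a p hp
      rw [hBG a] at hp
      obtain ⟨D, hD, hp⟩ := hp
      refine ⟨D, hsub D ?_ ⟨p, hp⟩, hp, ?_⟩
      · exact Finset.mem_union_right _ (Finset.mem_biUnion.2 ⟨a, Finset.mem_univ _, hD⟩)
      · rw [hBG a]
        exact subset_sUnion_of_mem hD)
  exact ⟨n, A, hA, fun D hD hne => (hA𝒟 D).1 (hsub D (Finset.mem_union_left _ hD) hne), hcut⟩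

namespace Connects

variable {𝒜 : Set (Set T)} {n : ℕ} {A : Fin (n + 1) → Set T} {f : Path T} {τ : Fin (n + 1) → ℝ}

theorem toFun_partition (hA : IsConsistentOrdering 𝒜 A) (hf : Connects 𝒜 A f τ)
    (i : Fin (n + 1)) : f.toFun (τ i) = initialUnion A i := by
  obtain ⟨⟨-, -, h0, -⟩, ⟨hτ0, -, hτ⟩, φ, hφ⟩ := hf
  refine Fin.cases ?_ (fun j => ?_) i
  · rw [hτ0, h0, initialUnion_zero, hA.zero]
  · obtain ⟨-, -, hend, hval⟩ := hφ j
    rw [hval _ (right_mem_Icc.2 (hτ (Fin.castSucc_lt_succ)).le), hend]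
    ext p
    simp only [partialUnion, mem_union, mem_iUnion, exists_prop, mem_initialUnion]
    constructor
    · rintro (⟨k, ⟨-, hk⟩, hp⟩ | hp)
      · exact ⟨k, hk.trans (Fin.castSucc_le_succ j), hp⟩
      · exact ⟨_, le_rfl, hp⟩
    · rintro ⟨k, hk, hp⟩
      by_cases hk0 : k = 0
      · exact Or.inr (hA.zero_subset _ (hk0 ▸ hp))
      · rcases hk.lt_or_eq with hlt | rfl
        · exact Or.inl ⟨k, ⟨Fin.pos_of_ne_zero hk0, Fin.le_castSucc_iff.2 hlt⟩, hp⟩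
        · exact Or.inr hp

theorem partition_mem_Icc (hf : Connects 𝒜 A f τ) (i : Fin (n + 1)) : τ i ∈ Icc 0 f.a := by
  obtain ⟨-, ⟨hτ0, hτ1, hτ⟩, -⟩ := hf
  exact ⟨hτ0 ▸ hτ.monotone (Fin.zero_le i), hτ1 ▸ hτ.monotone (Fin.le_last i)⟩

end Connects

/-- The data of the theorem: one-dimensional transition systems on flows chosen for all consistent
orderings, which satisfy the matching and the consistency conditions. -/
structure IsFlowSystem (𝒜 : Set (Set T)) (μ : Measure ℝ)
    (F : (n : ℕ) → (Fin (n + 1) → Set T) → Path T)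
    (τ : (n : ℕ) → (Fin (n + 1) → Set T) → Fin (n + 1) → ℝ)
    (Qf : Path T → ℝ → ℝ → Kernel ℝ ℝ) : Prop where
  indexing : IsIndexingCollection 𝒜
  connects : ∀ (n : ℕ) (A : Fin (n + 1) → Set T), IsConsistentOrdering 𝒜 A →
    Connects 𝒜 A (F n A) (τ n A)
  transition : ∀ f ∈ chosenFlows 𝒜 F, IsTransitionSystem (Icc 0 f.a) (Qf f)
  matching : Matching (chosenFlows 𝒜 F) Qf
  consistency : Consistency 𝒜 μ F τ Qf

namespace IsFlowSystem

variable {𝒜 : Set (Set T)} {μ : Measure ℝ}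
    {F : (n : ℕ) → (Fin (n + 1) → Set T) → Path T}
    {τ : (n : ℕ) → (Fin (n + 1) → Set T) → Fin (n + 1) → ℝ}
    {Qf : Path T → ℝ → ℝ → Kernel ℝ ℝ}

theorem toFun_mem (h : IsFlowSystem 𝒜 μ F τ Qf) {f : Path T} (hf : f ∈ chosenFlows 𝒜 F) {s : ℝ}
    (hs : s ∈ Icc 0 f.a) : f.toFun s ∈ finiteUnions 𝒜 := by
  obtain ⟨n, A, hA, rfl⟩ := hf
  exact (h.connects n A hA).1.1.1 s hs

theorem toFun_nonempty [CompactSpace T] [Nonempty T] (h : IsFlowSystem 𝒜 μ F τ Qf) {f : Path T}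
    (hf : f ∈ chosenFlows 𝒜 F) {s : ℝ} (hs : s ∈ Icc 0 f.a) : (f.toFun s).Nonempty := by
  obtain ⟨n, A, hA, rfl⟩ := hf
  obtain ⟨⟨⟨-, hmono⟩, -, h0, -⟩, -⟩ := h.connects n A hA
  have := hmono (left_mem_Icc.2 (hs.1.trans hs.2)) hs hs.1
  rw [h0] at this
  exact h.indexing.minimalSet_nonempty.mono this

theorem toFun_mono (h : IsFlowSystem 𝒜 μ F τ Qf) {f : Path T} (hf : f ∈ chosenFlows 𝒜 F)
    {s t : ℝ} (hs : s ∈ Icc 0 f.a) (ht : t ∈ Icc 0 f.a) (hst : s ≤ t) :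
    f.toFun s ⊆ f.toFun t := by
  obtain ⟨n, A, hA, rfl⟩ := hf
  exact (h.connects n A hA).1.1.2 hs ht hst

/-- By matching, the flow and the times used to define `flowKernel` do not matter. -/
theorem flowKernel_eq (h : IsFlowSystem 𝒜 μ F τ Qf) {f : Path T} (hf : f ∈ chosenFlows 𝒜 F)
    {s t : ℝ} (hs : s ∈ Icc 0 f.a) (ht : t ∈ Icc 0 f.a) (hst : s ≤ t) :
    flowKernel (chosenFlows 𝒜 F) Qf (f.toFun s) (f.toFun t) = Qf f s t := by
  have hex : ∃ p, LeadsTo (chosenFlows 𝒜 F) (f.toFun s) (f.toFun t) p :=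
    ⟨(f, s, t), hf, hs, ht, hst, rfl, rfl⟩
  rw [flowKernel, dif_pos hex]
  obtain ⟨h1, h2, h3, h4, h5, h6⟩ := hex.choose_spec
  exact h.matching _ h1 _ hf _ h2 _ h3 _ hs _ ht h4 hst h5 h6

theorem isMarkovKernel_flowKernel (h : IsFlowSystem 𝒜 μ F τ Qf) (B B' : Set T) :
    IsMarkovKernel (flowKernel (chosenFlows 𝒜 F) Qf B B') := by
  rw [flowKernel]
  split_ifs with hex
  · obtain ⟨h1, h2, h3, h4, -⟩ := hex.choose_spec
    exact (h.transition _ h1).markov _ h2 _ h3 h4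
  · infer_instance

theorem isMarkovKernel_setKernel [IsProbabilityMeasure μ] (h : IsFlowSystem 𝒜 μ F τ Qf)
    (B B' : Set T) : IsMarkovKernel (setKernel 𝒜 μ (chosenFlows 𝒜 F) Qf B B') := by
  have := h.isMarkovKernel_flowKernel
  rw [setKernel]
  split_ifs <;> infer_instance

theorem setKernel_eq [CompactSpace T] [Nonempty T] (h : IsFlowSystem 𝒜 μ F τ Qf) {f : Path T}
    (hf : f ∈ chosenFlows 𝒜 F) {s t : ℝ} (hs : s ∈ Icc 0 f.a) (ht : t ∈ Icc 0 f.a)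
    (hst : s ≤ t) :
    setKernel 𝒜 μ (chosenFlows 𝒜 F) Qf (f.toFun s) (f.toFun t) = Qf f s t := by
  rw [setKernel_of_nonempty (h.toFun_nonempty hf hs), h.flowKernel_eq hf hs ht hst]

/-- Every finite chain of non-empty sets of `𝒜(u)` is visited, at increasing times, by a single
chosen flow: the one along an ordering cut at all members of the chain. -/
theorem exists_flow [CompactSpace T] [Nonempty T] (h : IsFlowSystem 𝒜 μ F τ Qf) {m : ℕ}
    (B : Fin m → Set T) (hB : Monotone B) (hBu : ∀ a, B a ∈ finiteUnions 𝒜)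
    (hBne : ∀ a, (B a).Nonempty) :
    ∃ f ∈ chosenFlows 𝒜 F, ∃ t : Fin m → ℝ, Monotone t ∧ (∀ a, t a ∈ Icc 0 f.a) ∧
      ∀ a, f.toFun (t a) = B a := by
  obtain ⟨n, A, hA, -, hcut⟩ := h.indexing.exists_ordering_isCut ∅ (by simp) B hB hBu hBne
  choose k hk using hcut
  have hc := h.connects n A hA
  refine ⟨F n A, ⟨n, A, hA, rfl⟩, fun a => τ n A (k a), ?_, fun a => hc.partition_mem_Icc _,
    fun a => ?_⟩
  · exact fun a b hab => hc.2.1.2.2.monotone ((hk a).le (hk b) (hB hab))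
  · rw [hc.toFun_partition hA, (hk a).initialUnion_eq]

/-- Three nested sets lie on one flow, so the Chapman-Kolmogorov equation is that of the flow. -/
theorem flowKernel_comp [CompactSpace T] [Nonempty T] (h : IsFlowSystem 𝒜 μ F τ Qf)
    {B₁ B₂ B₃ : Set T} (h₁ : B₁ ∈ finiteUnions 𝒜) (h₂ : B₂ ∈ finiteUnions 𝒜)
    (h₃ : B₃ ∈ finiteUnions 𝒜) (hne : B₁.Nonempty) (h₁₂ : B₁ ⊆ B₂) (h₂₃ : B₂ ⊆ B₃) :
    flowKernel (chosenFlows 𝒜 F) Qf B₁ B₃ =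
      flowKernel (chosenFlows 𝒜 F) Qf B₂ B₃ ∘ₖ flowKernel (chosenFlows 𝒜 F) Qf B₁ B₂ := by
  obtain ⟨f, hf, t, htm, hta, ht⟩ := h.exists_flow ![B₁, B₂, B₃]
    (by
      refine Fin.monotone_iff_le_succ.2 fun i => ?_
      fin_cases i
      · exact h₁₂
      · exact h₂₃)
    (by intro a; fin_cases a <;> assumption)
    (by
      intro a
      fin_cases a
      · exact hne
      · exact hne.mono h₁₂
      · exact hne.mono (h₁₂.trans h₂₃))
  have e₁ : f.toFun (t 0) = B₁ := ht 0
  have e₂ : f.toFun (t 1) = B₂ := ht 1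
  have e₃ : f.toFun (t 2) = B₃ := ht 2
  have l₁₂ : t 0 ≤ t 1 := htm (by decide)
  have l₂₃ : t 1 ≤ t 2 := htm (by decide)
  rw [← e₁, ← e₂, ← e₃, h.flowKernel_eq hf (hta 0) (hta 2) (l₁₂.trans l₂₃),
    h.flowKernel_eq hf (hta 1) (hta 2) l₂₃, h.flowKernel_eq hf (hta 0) (hta 1) l₁₂]
  exact (h.transition f hf).comp _ (hta 0) _ (hta 1) _ (hta 2) l₁₂ l₂₃

theorem setKernel_refl [CompactSpace T] [Nonempty T] (h : IsFlowSystem 𝒜 μ F τ Qf)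
    {B : Set T} (hB : B ∈ finiteUnions 𝒜) :
    setKernel 𝒜 μ (chosenFlows 𝒜 F) Qf B B = Kernel.id := by
  rw [setKernel, if_neg (fun h => h.2 h.1)]
  rcases B.eq_empty_or_nonempty with rfl | hne
  · refine dif_neg ?_
    rintro ⟨p, h1, h2, -, -, h5, -⟩
    exact (h.toFun_nonempty h1 h2).ne_empty h5
  · obtain ⟨f, hf, t, -, hta, ht⟩ := h.exists_flow (fun _ : Fin 1 => B) (fun _ _ _ => le_rfl)
      (fun _ => hB) (fun _ => hne)
    rw [← ht 0, h.flowKernel_eq hf (hta 0) (hta 0) le_rfl]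
    exact (h.transition f hf).refl _ (hta 0)

theorem isTransitionSystem_setKernel [CompactSpace T] [Nonempty T] [IsProbabilityMeasure μ]
    (h : IsFlowSystem 𝒜 μ F τ Qf) :
    IsTransitionSystem (finiteUnions 𝒜) (setKernel 𝒜 μ (chosenFlows 𝒜 F) Qf) where
  markov B _ B' _ _ := h.isMarkovKernel_setKernel B B'
  refl B hB := h.setKernel_refl hB
  comp B₁ h₁ B₂ h₂ B₃ h₃ h₁₂ h₂₃ := by
    rcases B₁.eq_empty_or_nonempty with rfl | hne
    · rcases B₂.eq_empty_or_nonempty with rfl | hne₂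
      · rw [h.setKernel_refl h₁, Kernel.comp_id]
      · have hne₃ : B₃.Nonempty := hne₂.mono h₂₃
        rw [setKernel_of_nonempty hne₂, setKernel, setKernel, if_pos ⟨rfl, hne₃.ne_empty⟩,
          if_pos ⟨rfl, hne₂.ne_empty⟩, ← Kernel.comp_assoc, ← h.flowKernel_comp
            (mem_finiteUnions h.indexing.minimalSet_mem) h₂ h₃ h.indexing.minimalSet_nonempty
            (minimalSet_subset_of_mem_finiteUnions h₂ hne₂) h₂₃]
    · rw [setKernel_of_nonempty hne, setKernel_of_nonempty hne,
        setKernel_of_nonempty (hne.mono h₁₂)]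
      exact h.flowKernel_comp h₁ h₂ h₃ hne h₁₂ h₂₃

/-- The law of `X` at `∅', A 1, A 1 ∪ A 2, …` prescribed by the transition system. -/
def unionLaw (𝒜 : Set (Set T)) (μ : Measure ℝ) (F : (n : ℕ) → (Fin (n + 1) → Set T) → Path T)
    (Qf : Path T → ℝ → ℝ → Kernel ℝ ℝ) {n : ℕ} (A : Fin (n + 1) → Set T) :
    Measure (Fin (n + 1) → ℝ) :=
  chainLaw μ n fun i => setKernel 𝒜 μ (chosenFlows 𝒜 F) Qf
    (initialUnion A i.castSucc) (initialUnion A i.succ)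

theorem unionLaw_eq [CompactSpace T] [Nonempty T] (h : IsFlowSystem 𝒜 μ F τ Qf) {n : ℕ}
    {A : Fin (n + 1) → Set T} (hA : IsConsistentOrdering 𝒜 A) :
    unionLaw 𝒜 μ F Qf A =
      chainLaw μ n fun i => Qf (F n A) (τ n A i.castSucc) (τ n A i.succ) := by
  rw [unionLaw]
  congr 1
  ext1 i
  have hc := h.connects n A hA
  rw [← hc.toFun_partition hA, ← hc.toFun_partition hA,
    h.setKernel_eq ⟨n, A, hA, rfl⟩ (hc.partition_mem_Icc _) (hc.partition_mem_Icc _)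
      (hc.2.1.2.2.monotone (Fin.castSucc_le_succ i))]

end IsFlowSystem

end

/-! ### Finite-dimensional distributions and existence of the process -/

section

variable {T : Type*} [TopologicalSpace T]

namespace IsFlowSystem

variable {𝒜 : Set (Set T)} {μ : Measure ℝ} [IsProbabilityMeasure μ]
    {F : (n : ℕ) → (Fin (n + 1) → Set T) → Path T}
    {τ : (n : ℕ) → (Fin (n + 1) → Set T) → Fin (n + 1) → ℝ}
    {Qf : Path T → ℝ → ℝ → Kernel ℝ ℝ}

theorem isProbabilityMeasure_unionLaw (h : IsFlowSystem 𝒜 μ F τ Qf) {n : ℕ}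
    (A : Fin (n + 1) → Set T) : IsProbabilityMeasure (unionLaw 𝒜 μ F Qf A) := by
  have := h.isMarkovKernel_setKernel
  exact isProbabilityMeasure_chainLaw μ n _

/-- Almost surely, the values at the unions `A 0 ∪ … ∪ A i` come from a point measure: where the
sequence of unions stands still, so does the chain. -/
theorem ae_exists_pointMass [CompactSpace T] [Nonempty T] (h : IsFlowSystem 𝒜 μ F τ Qf) {n : ℕ}
    {A : Fin (n + 1) → Set T} (hA : IsConsistentOrdering 𝒜 A) :
    ∀ᵐ x ∂unionLaw 𝒜 μ F Qf A, ∃ c, ∀ i, pointMass c (initialUnion A i) = x i := by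
  have := h.isMarkovKernel_setKernel
  have hae : ∀ᵐ x ∂unionLaw 𝒜 μ F Qf A, ∀ i : Fin n,
      initialUnion A i.castSucc = initialUnion A i.succ → x i.succ = x i.castSucc := by
    refine ae_all_iff.2 fun i => ?_
    by_cases heq : initialUnion A i.castSucc = initialUnion A i.succ
    · filter_upwards [chainLaw_ae_eq h.isTransitionSystem_setKernel μ (initialUnion A)
        (monotone_initialUnion A) (initialUnion_mem_finiteUnions h.indexing hA)
        (Fin.castSucc_le_succ i) heq] with x hx _
      exact hx
    · exact ae_of_all _ fun x hx => absurd hx heq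
  filter_upwards [hae] with x hx
  obtain ⟨c, hc, -⟩ := exists_pointMass_eq (initialUnion A) (monotone_initialUnion A)
    (by
      rw [initialUnion_zero, hA.zero]
      exact h.indexing.minimalSet_nonempty) x hx
  exact ⟨c, hc⟩

/-- The law of the process on the semilattice of `A`, computed along the ordering `A`. It is put on
the space of all set functions; only its marginals on the sets of the ordering (and on the empty
set) are meaningful. Off `𝒜` the process is set to zero. -/
def valueLaw (𝒜 : Set (Set T)) (μ : Measure ℝ) (F : (n : ℕ) → (Fin (n + 1) → Set T) → Path T)
    (Qf : Path T → ℝ → ℝ → Kernel ℝ ℝ) {n : ℕ} (A : Fin (n + 1) → Set T) :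
    Measure (Set T → ℝ) :=
  (unionLaw 𝒜 μ F Qf A).map fun x => 𝒜.indicator (valueOf A x)

/-- By consistency, the law of the process on a semilattice does not depend on the ordering. -/
theorem valueLaw_eq_of_image_eq [CompactSpace T] [Nonempty T] (h : IsFlowSystem 𝒜 μ F τ Qf)
    {n n' : ℕ} {A : Fin (n + 1) → Set T} {A' : Fin (n' + 1) → Set T}
    (hA : IsConsistentOrdering 𝒜 A) (hA' : IsConsistentOrdering 𝒜 A')
    (himage : A '' {0}ᶜ = A' '' {0}ᶜ) : valueLaw 𝒜 μ F Qf A = valueLaw 𝒜 μ F Qf A' := by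
  classical
  obtain ⟨rfl, π, hπ0, hπ1, hπ⟩ := hA.exists_perm hA' himage
  simp only [Fin.cast_eq_self] at hπ
  have hcons := h.consistency n' A A' hA hA' π hπ0 hπ1 hπ
  rw [← h.unionLaw_eq hA, ← h.unionLaw_eq hA'] at hcons
  have h1 : Measurable fun (x : Fin (n' + 1) → ℝ) i => increment x i :=
    measurable_pi_iff.2 measurable_increment
  have h2 : Measurable fun (x : Fin (n' + 1) → ℝ) i => increment x (π i) :=
    measurable_pi_iff.2 fun i => measurable_increment (π i)
  have := h.isProbabilityMeasure_unionLaw A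
  have := Measure.isProbabilityMeasure_map (μ := unionLaw 𝒜 μ F Qf A) h1.aemeasurable
  have := h.isProbabilityMeasure_unionLaw A'
  have := Measure.isProbabilityMeasure_map (μ := unionLaw 𝒜 μ F Qf A') h2.aemeasurable
  have hlaw : (unionLaw 𝒜 μ F Qf A).map (fun x i => increment x i) =
      (unionLaw 𝒜 μ F Qf A').map (fun x i => increment x (π i)) := by
    refine ext_of_generate_finite _ generateFrom_pi.symm isPiSystem_pi ?_ (by simp)
    rintro _ ⟨Γ, hΓ, rfl⟩
    have hΓ' : ∀ i, MeasurableSet (Γ i) := fun i => hΓ i (mem_univ i)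
    rw [Measure.map_apply h1 (MeasurableSet.univ_pi hΓ'),
      Measure.map_apply h2 (MeasurableSet.univ_pi hΓ')]
    convert hcons Γ hΓ' using 2 <;>
    · ext x
      simp
  -- the process is a function of its increments, in which `A'` is relabelled through `π`
  set W : (Fin (n' + 1) → ℝ) → Set T → ℝ := fun y =>
    𝒜.indicator fun D => ∑ i, if i ≠ 0 ∧ A i ⊆ D then y i else 0 with hW
  have hWm : Measurable W := by
    refine measurable_pi_iff.2 fun D => ?_
    by_cases hD : D ∈ 𝒜
    · simp only [hW, indicator_of_mem hD]
      refine Finset.measurable_sum _ fun i _ => ?_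
      split_ifs <;> fun_prop
    · simp only [hW, indicator_of_notMem hD, measurable_const]
  have e1 : (fun x => 𝒜.indicator (valueOf A x)) = W ∘ fun x i => increment x i := rfl
  have e2 : (fun x => 𝒜.indicator (valueOf A' x)) = W ∘ fun x i => increment x (π i) := by
    ext1 x
    simp only [hW, Function.comp]
    congr 1
    ext1 D
    rw [valueOf, ← Equiv.sum_comp π]
    refine Finset.sum_congr rfl fun i _ => ?_
    have : π i ≠ 0 ↔ i ≠ 0 := by
      rw [not_iff_not, ← hπ0, π.injective.eq_iff]
      rw [hπ0]
    simp only [hπ i, this]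
  rw [valueLaw, valueLaw, e1, e2, ← Measure.map_map hWm h1, hlaw, Measure.map_map hWm h2]

/-- If `A'` is an ordering of a larger semilattice that is cut at all the unions
`A 0 ∪ … ∪ A i`, then the laws computed along `A` and `A'` agree on the sets of `A`. -/
theorem valueLaw_marginal_of_isCut [CompactSpace T] [Nonempty T] (h : IsFlowSystem 𝒜 μ F τ Qf)
    {n n' : ℕ} {A : Fin (n + 1) → Set T} {A' : Fin (n' + 1) → Set T}
    (hA : IsConsistentOrdering 𝒜 A) (hA' : IsConsistentOrdering 𝒜 A')
    (hsub : ∀ i, i ≠ 0 → ∃ j, j ≠ 0 ∧ A' j = A i)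
    (hcut : ∀ i, ∃ k, IsCut A' (initialUnion A i) k) (J : Finset (Set T))
    (hJ : ∀ D ∈ J, D ∈ 𝒜 → D.Nonempty → ∃ i, i ≠ 0 ∧ A i = D) :
    (valueLaw 𝒜 μ F Qf A).map J.restrict = (valueLaw 𝒜 μ F Qf A').map J.restrict := by
  classical
  have := h.isMarkovKernel_setKernel
  choose k₀ hk₀ using hcut
  -- the chain of `A` starts at time `0`, which sits at `∅'` for both orderings
  set k : Fin (n + 1) → Fin (n' + 1) := fun i => if i = 0 then 0 else k₀ i with hk
  have hk0 : k 0 = 0 := if_pos rfl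
  have hkmono : Monotone k := by
    intro i j hij
    by_cases hi : i = 0
    · simp [hk, hi]
    · have hj : j ≠ 0 := fun hj => hi (Fin.le_zero_iff.1 (hj ▸ hij))
      simp only [hk, if_neg hi, if_neg hj]
      exact (hk₀ i).le (hk₀ j) (monotone_initialUnion A hij)
  have hkU : ∀ i, initialUnion A' (k i) = initialUnion A i := by
    intro i
    by_cases hi : i = 0
    · simp [hk, hi, hA.zero, hA'.zero]
    · simp only [hk, if_neg hi]
      exact (hk₀ i).initialUnion_eq
  have hchain : (unionLaw 𝒜 μ F Qf A').map (fun x i => x (k i)) = unionLaw 𝒜 μ F Qf A := by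
    rw [unionLaw, map_chainLaw_comp h.isTransitionSystem_setKernel μ (initialUnion A')
      (monotone_initialUnion A') (initialUnion_mem_finiteUnions h.indexing hA') k hkmono hk0]
    simp only [hkU, unionLaw]
  have hkm : Measurable fun (x : Fin (n' + 1) → ℝ) i => x (k i) := by fun_prop
  have hJm : Measurable (J.restrict : (Set T → ℝ) → _) := Finset.measurable_restrict J
  rw [valueLaw, valueLaw, ← hchain, Measure.map_map (measurable_indicator_valueOf 𝒜 A) hkm,
    Measure.map_map hJm ((measurable_indicator_valueOf 𝒜 A).comp hkm),
    Measure.map_map hJm (measurable_indicator_valueOf 𝒜 A')]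
  refine Measure.map_congr ?_
  filter_upwards [h.ae_exists_pointMass hA'] with x hx
  obtain ⟨c, hc⟩ := hx
  have hx : x = fun j => pointMass c (initialUnion A' j) := funext fun j => (hc j).symm
  have hxk : (fun i => x (k i)) = fun i => pointMass c (initialUnion A i) := by
    ext i
    rw [← hc, hkU]
  ext ⟨D, hD⟩
  simp only [Function.comp, Finset.restrict]
  by_cases hD𝒜 : D ∈ 𝒜
  · rw [indicator_of_mem hD𝒜, indicator_of_mem hD𝒜, hxk]
    rcases D.eq_empty_or_nonempty with rfl | hne
    · rw [hA.valueOf_empty, hA'.valueOf_empty]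
    · obtain ⟨i, hi, rfl⟩ := hJ D hD hD𝒜 hne
      obtain ⟨j, hj, hji⟩ := hsub i hi
      rw [hA.valueOf_pointMass c hi, ← hji, hx, hA'.valueOf_pointMass c hj]
  · rw [indicator_of_notMem hD𝒜, indicator_of_notMem hD𝒜]

/-- The laws computed along any two orderings agree on the sets that they share. -/
theorem valueLaw_marginal_eq [CompactSpace T] [Nonempty T] (h : IsFlowSystem 𝒜 μ F τ Qf)
    {n n' : ℕ} {A : Fin (n + 1) → Set T} {A' : Fin (n' + 1) → Set T}
    (hA : IsConsistentOrdering 𝒜 A) (hA' : IsConsistentOrdering 𝒜 A') (J : Finset (Set T))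
    (hJ : ∀ D ∈ J, D ∈ 𝒜 → D.Nonempty → ∃ i, i ≠ 0 ∧ A i = D)
    (hJ' : ∀ D ∈ J, D ∈ 𝒜 → D.Nonempty → ∃ i, i ≠ 0 ∧ A' i = D) :
    (valueLaw 𝒜 μ F Qf A).map J.restrict = (valueLaw 𝒜 μ F Qf A').map J.restrict := by
  classical
  have hmem : ∀ {m : ℕ} {C : Fin (m + 1) → Set T}, IsConsistentOrdering 𝒜 C →
      ∀ i, C i ∈ 𝒜 ∧ (C i).Nonempty := by
    intro m C hC i
    by_cases hi : i = 0
    · rw [hi, hC.zero]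
      exact ⟨h.indexing.minimalSet_mem, h.indexing.minimalSet_nonempty⟩
    · exact ⟨hC.mem i hi, hC.nonempty i hi⟩
  obtain ⟨𝒟, h𝒟, hinter, hmin, hsub⟩ := h.indexing.exists_semilattice
    (Finset.univ.image A ∪ Finset.univ.image A') (by
      intro D hD
      simp only [Finset.coe_union, Finset.coe_image, Finset.coe_univ, image_univ, mem_union,
        mem_range] at hD
      rcases hD with ⟨i, rfl⟩ | ⟨i, rfl⟩
      · exact (hmem hA i).1
      · exact (hmem hA' i).1)
  have hsubA : ∀ i, A i ∈ 𝒟 := fun i => hsub _ (by simp) (hmem hA i).2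
  have hsubA' : ∀ i, A' i ∈ 𝒟 := fun i => hsub _ (by simp) (hmem hA' i).2
  have hord : ∀ {m : ℕ} {C : Fin (m + 1) → Set T}, IsConsistentOrdering 𝒜 C →
      (∀ i, C i ∈ 𝒟) → (∀ D ∈ J, D ∈ 𝒜 → D.Nonempty → ∃ i, i ≠ 0 ∧ C i = D) →
      ∃ (l : ℕ) (E : Fin (l + 1) → Set T), IsConsistentOrdering 𝒜 E ∧ E '' {0}ᶜ = 𝒟 ∧
        (valueLaw 𝒜 μ F Qf C).map J.restrict = (valueLaw 𝒜 μ F Qf E).map J.restrict := by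
    intro m C hC hC𝒟 hCJ
    obtain ⟨l, E, hE, hE𝒟, hcut⟩ := SetIndexed.exists_ordering_isCut 𝒟 h𝒟 hinter hmin
      (initialUnion C) (monotone_initialUnion C)
      (fun i => (hmem hC 0).2.mono (by
        rw [← initialUnion_zero C]
        exact monotone_initialUnion C (Fin.zero_le i)))
      (by
        intro i p hp
        obtain ⟨j, hj, hpj⟩ := mem_initialUnion.1 hp
        exact ⟨C j, hC𝒟 j, hpj, fun q hq => mem_initialUnion.2 ⟨j, hj, hq⟩⟩)
    refine ⟨l, E, hE, ?_, h.valueLaw_marginal_of_isCut hC hE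
      (fun i _ => (hE𝒟 _).1 (hC𝒟 i)) hcut J hCJ⟩
    ext D
    rw [Finset.mem_coe, hE𝒟]
    simp
  obtain ⟨l, E, hE, hE𝒟, hlaw⟩ := hord hA hsubA hJ
  obtain ⟨l', E', hE', hE𝒟', hlaw'⟩ := hord hA' hsubA' hJ'
  rw [hlaw, hlaw', h.valueLaw_eq_of_image_eq hE hE' (hE𝒟.trans hE𝒟'.symm)]

/-- The process `X` on `(Ω, P)` has the prescribed finite-dimensional marginals. -/
structure HasMarginals {Ω : Type*} [MeasurableSpace Ω] (𝒜 : Set (Set T)) (μ : Measure ℝ)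
    (F : (n : ℕ) → (Fin (n + 1) → Set T) → Path T) (Qf : Path T → ℝ → ℝ → Kernel ℝ ℝ)
    (P : Measure Ω) (X : Set T → Ω → ℝ) : Prop where
  measurable : ∀ D, Measurable (X D)
  map_eq : ∀ {n : ℕ} {A : Fin (n + 1) → Set T}, IsConsistentOrdering 𝒜 A →
    ∀ J : Finset (Set T), (∀ D ∈ J, D ∈ 𝒜 → D.Nonempty → ∃ i, i ≠ 0 ∧ A i = D) →
    P.map (fun ω => J.restrict fun D => X D ω) = (valueLaw 𝒜 μ F Qf A).map J.restrict

/-- The process exists on a complete probability space. -/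
theorem exists_hasMarginals {T : Type u} [TopologicalSpace T] {𝒜 : Set (Set T)}
    {F : (n : ℕ) → (Fin (n + 1) → Set T) → Path T}
    {τ : (n : ℕ) → (Fin (n + 1) → Set T) → Fin (n + 1) → ℝ}
    {Qf : Path T → ℝ → ℝ → Kernel ℝ ℝ} [CompactSpace T] [Nonempty T]
    (h : IsFlowSystem 𝒜 μ F τ Qf) :
    ∃ (Ω : Type u) (_ : MeasurableSpace Ω) (P : Measure Ω) (X : Set T → Ω → ℝ),
      IsProbabilityMeasure P ∧ P.IsComplete ∧ HasMarginals 𝒜 μ F Qf P X := by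
  classical
  have hord : ∀ J : Finset (Set T), ∃ (n : ℕ) (A : Fin (n + 1) → Set T),
      IsConsistentOrdering 𝒜 A ∧ ∀ D ∈ J, D ∈ 𝒜 → D.Nonempty → ∃ i, i ≠ 0 ∧ A i = D := by
    intro J
    obtain ⟨n, A, hA, hJ, -⟩ := h.indexing.exists_ordering_isCut (J.filter (· ∈ 𝒜))
      (fun D hD => (Finset.mem_filter.1 hD).2) (m := 0) Fin.elim0 (fun a => a.elim0)
      (fun a => a.elim0) (fun a => a.elim0)
    exact ⟨n, A, hA, fun D hD hD𝒜 hne => hJ D (Finset.mem_filter.2 ⟨hD, hD𝒜⟩) hne⟩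
  choose n A hA hAJ using hord
  set M : ∀ J : Finset (Set T), Measure (J → ℝ) := fun J =>
    (valueLaw 𝒜 μ F Qf (A J)).map J.restrict with hM
  have hMp : ∀ J, IsProbabilityMeasure (M J) := by
    intro J
    have := h.isProbabilityMeasure_unionLaw (A J)
    have : IsProbabilityMeasure (valueLaw 𝒜 μ F Qf (A J)) :=
      Measure.isProbabilityMeasure_map (measurable_indicator_valueOf 𝒜 (A J)).aemeasurable
    exact Measure.isProbabilityMeasure_map (Finset.measurable_restrict J).aemeasurable
  have hMproj : IsProjectiveMeasureFamily (α := fun _ : Set T => ℝ) M := by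
    intro I J hJI
    simp only [hM]
    rw [Measure.map_map (Finset.measurable_restrict₂ hJI) (Finset.measurable_restrict I),
      Finset.restrict₂_comp_restrict]
    exact h.valueLaw_marginal_eq (hA J) (hA I) J (hAJ J) fun D hD => hAJ I D (hJI hD)
  obtain ⟨ν, hν⟩ := exists_isProjectiveLimit hMproj
  have hνp : IsProbabilityMeasure ν := hν.isProbabilityMeasure
  refine ⟨NullMeasurableSpace (Set T → ℝ) ν, inferInstance, ν.completion,
    fun D (ω : Set T → ℝ) => ω D, ⟨?_⟩, inferInstance, ?_, ?_⟩
  · exact (Measure.completion_apply ν univ).trans measure_univ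
  · intro D s hs
    exact (measurable_pi_apply D hs).nullMeasurableSet
  · intro m C hC J hJ
    set g : NullMeasurableSpace (Set T → ℝ) ν → J → ℝ :=
      fun ω => J.restrict fun D => (ω : Set T → ℝ) D with hg
    have hgm : Measurable g := fun s hs => (Finset.measurable_restrict J hs).nullMeasurableSet
    have : ν.completion.map g = ν.map J.restrict := by
      ext s hs
      rw [Measure.map_apply hgm hs, Measure.map_apply (Finset.measurable_restrict J) hs]
      exact Measure.completion_apply ν _
    refine this.trans ?_
    rw [hν J]
    exact h.valueLaw_marginal_eq (hA J) hC J (hAJ J) hJ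

end IsFlowSystem

end

/-! ### Additivity of the process -/

section

variable {T : Type*}

/-- The restrictions of point measures to finitely many sets form the range of a linear map into a
finite-dimensional space, hence a closed set. -/
theorem measurableSet_exists_pointMass (J : Finset (Set T)) :
    MeasurableSet {v : Set T → ℝ | ∃ c, ∀ D ∈ J, v D = pointMass c D} := by
  let Φ : (T →₀ ℝ) →ₗ[ℝ] (J → ℝ) :=
    LinearMap.pi fun D => Finsupp.linearCombination ℝ ((D : Set T).indicator (1 : T → ℝ))
  have hΦ : ∀ c (D : J), Φ c D = pointMass c D := fun c D => by
    rw [pointMass_eq_linearCombination]; rfl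
  have heq : {v : Set T → ℝ | ∃ c, ∀ D ∈ J, v D = pointMass c D} =
      J.restrict ⁻¹' (LinearMap.range Φ : Set (J → ℝ)) := by
    ext v
    simp only [mem_ofPred_eq, mem_preimage, SetLike.mem_coe, LinearMap.mem_range]
    refine exists_congr fun c => ?_
    constructor
    · intro hv
      ext D
      rw [hΦ, Finset.restrict, hv D D.2]
    · intro hv D hD
      rw [← hΦ c ⟨D, hD⟩, hv]
      rfl
  rw [heq]
  exact Finset.measurable_restrict J (LinearMap.range Φ).closed_of_finiteDimensional.measurableSet

/-- The intersections of the non-empty subfamilies of `F`. -/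
def intersections (F : Finset (Set T)) : Finset (Set T) :=
  open Classical in
  (F.powerset.filter fun G => G.Nonempty).image fun G : Finset (Set T) => ⋂₀ (G : Set (Set T))

theorem mem_intersections {F : Finset (Set T)} {D : Set T} :
    D ∈ intersections F ↔ ∃ G ⊆ F, G.Nonempty ∧ ⋂₀ (G : Set (Set T)) = D := by
  simp only [intersections, Finset.mem_image, Finset.mem_filter, Finset.mem_powerset, and_assoc]

theorem inclExcl_eq_pointMass {x : Set T → ℝ} {F : Finset (Set T)} {c : T →₀ ℝ}
    (h : ∀ D ∈ intersections F, x D = pointMass c D) :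
    inclExcl x F = pointMass c (⋃₀ (F : Set (Set T))) := by
  rw [pointMass_sUnion]
  exact inclExcl_congr fun G hG hne => h _ (mem_intersections.2 ⟨G, hG, hne, rfl⟩)

theorem union_mem_finiteUnions {𝒜 : Set (Set T)} {B B' : Set T} (hB : B ∈ finiteUnions 𝒜)
    (hB' : B' ∈ finiteUnions 𝒜) : B ∪ B' ∈ finiteUnions 𝒜 := by
  classical
  obtain ⟨F, hF, rfl⟩ := hB
  obtain ⟨F', hF', rfl⟩ := hB'
  exact ⟨F ∪ F', by simp [hF, hF'], by rw [Finset.coe_union, sUnion_union]⟩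

/-- `J` is a finite set of sites which cover `B` and at which a process determines its additive
extension to `B`. -/
structure Determines (𝒜 : Set (Set T)) (B : Set T) (J : Finset (Set T)) : Prop where
  mem : ∀ D ∈ J, D ∈ 𝒜 ∧ D ⊆ B
  cover : ∀ p ∈ B, ∃ D ∈ J, p ∈ D
  dependsOn : DependsOn (fun x : Set T → ℝ => extU 𝒜 x B) (J : Set (Set T))
  extU_pointMass : ∀ c, extU 𝒜 (pointMass c) B = pointMass c B

theorem exists_extU_eq {𝒜 : Set (Set T)} {B : Set T} (hB : B ∈ finiteUnions 𝒜) :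
    ∃ F : Finset (Set T), (F : Set (Set T)) ⊆ 𝒜 ∧ B = ⋃₀ (F : Set (Set T)) ∧
      ∀ x, extU 𝒜 x B = inclExcl x F :=
  ⟨hB.choose, hB.choose_spec.1, hB.choose_spec.2, fun _ => dif_pos hB⟩

theorem Determines.extU_eq {𝒜 : Set (Set T)} {B : Set T} {J : Finset (Set T)} (h : Determines 𝒜 B J)
    {x : Set T → ℝ} {c : T →₀ ℝ} (hx : ∀ D ∈ J, x D = pointMass c D) :
    extU 𝒜 x B = pointMass c B :=
  (h.dependsOn hx).trans (h.extU_pointMass c)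

variable [TopologicalSpace T] {𝒜 : Set (Set T)}

theorem IsIndexingCollection.intersections_mem (h𝒜 : IsIndexingCollection 𝒜)
    {F : Finset (Set T)} (hF : (F : Set (Set T)) ⊆ 𝒜) {D : Set T} (hD : D ∈ intersections F) :
    D ∈ 𝒜 ∧ D ⊆ ⋃₀ (F : Set (Set T)) := by
  obtain ⟨G, hG, ⟨A, hA⟩, rfl⟩ := mem_intersections.1 hD
  exact ⟨h𝒜.sInter_mem _ fun E hE => hF (hG hE), fun p hp => ⟨A, hG hA, hp A hA⟩⟩

theorem inter_mem_finiteUnions (h𝒜 : IsIndexingCollection 𝒜) {A B : Set T} (hA : A ∈ 𝒜)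
    (hB : B ∈ finiteUnions 𝒜) : A ∩ B ∈ finiteUnions 𝒜 := by
  classical
  obtain ⟨F, hF, rfl⟩ := hB
  refine ⟨F.image fun D => A ∩ D, ?_, ?_⟩
  · intro D hD
    rw [Finset.coe_image] at hD
    obtain ⟨E, hE, rfl⟩ := hD
    exact h𝒜.inter_mem hA (hF hE)
  · rw [Finset.coe_image, sUnion_image, sUnion_eq_biUnion, inter_iUnion₂]

/-- The extension of `x` to `B ∈ 𝒜(u)` is a function of finitely many values of `x` on sets that
cover `B`, and equals the mass of `B` if these values are those of a point measure. -/
theorem IsIndexingCollection.exists_determines (h𝒜 : IsIndexingCollection 𝒜) {B : Set T}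
    (hB : B ∈ finiteUnions 𝒜) : ∃ J, Determines 𝒜 B J := by
  obtain ⟨F, hF, rfl, hext⟩ := exists_extU_eq hB
  refine ⟨intersections F, fun D hD => h𝒜.intersections_mem hF hD, ?_, ?_, ?_⟩
  · rintro p ⟨D, hD, hp⟩
    exact ⟨D, mem_intersections.2 ⟨{D}, by simpa using hD, by simp, by simp⟩, hp⟩
  · intro x y hxy
    simp only [hext]
    exact inclExcl_congr fun G hG hne => hxy _ (mem_intersections.2 ⟨G, hG, hne, rfl⟩)
  · intro c
    rw [hext, inclExcl_eq_pointMass fun D _ => rfl]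

theorem IsIndexingCollection.measurable_extU (h𝒜 : IsIndexingCollection 𝒜) {B : Set T}
    (hB : B ∈ finiteUnions 𝒜) {Ω : Type*} (m : MeasurableSpace Ω) (X : Set T → Ω → ℝ)
    (hX : ∀ D ∈ 𝒜, D ⊆ B → Measurable[m] (X D)) :
    Measurable[m] fun ω => extU 𝒜 (fun D => X D ω) B := by
  obtain ⟨F, hF, rfl, hext⟩ := exists_extU_eq hB
  simp only [hext, inclExcl]
  refine Finset.measurable_sum _ fun G hG => ?_
  rw [Finset.mem_filter, Finset.mem_powerset] at hG
  have := h𝒜.intersections_mem hF (mem_intersections.2 ⟨G, hG.1, hG.2, rfl⟩)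
  exact (hX _ this.1 this.2).const_mul _

theorem IsIndexingCollection.measurable_valueAt (h𝒜 : IsIndexingCollection 𝒜) {B : Set T}
    (hB : B ∈ finiteUnions 𝒜) {Ω : Type*} (X : Set T → Ω → ℝ) :
    Measurable[minFiltration 𝒜 X B] (valueAt 𝒜 X B) :=
  h𝒜.measurable_extU hB _ X fun D hD hDB =>
    Measurable.mono (comap_measurable (X D)) (le_iSup₂_of_le D ⟨hD, hDB⟩ le_rfl) le_rfl

theorem IsIndexingCollection.exists_extC_eq (h𝒜 : IsIndexingCollection 𝒜) {C : Set T}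
    (hC : C ∈ differences 𝒜) :
    ∃ J : Finset (Set T), (J : Set (Set T)) ⊆ 𝒜 ∧ ∀ (x : Set T → ℝ) (c : T →₀ ℝ),
      (∀ D ∈ J, x D = pointMass c D) → extC 𝒜 x C = pointMass c C := by
  classical
  have hex : ∃ p : Set T × Set T, p.1 ∈ 𝒜 ∧ p.2 ∈ finiteUnions 𝒜 ∧ C = p.1 \ p.2 := by
    obtain ⟨A, hA, B, hB, rfl⟩ := hC
    exact ⟨(A, B), hA, hB, rfl⟩
  obtain ⟨hA, hB, hAB⟩ := hex.choose_spec
  obtain ⟨J, hJ⟩ := h𝒜.exists_determines (inter_mem_finiteUnions h𝒜 hA hB)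
  refine ⟨insert hex.choose.1 J, ?_, fun x c hx => ?_⟩
  · rw [Finset.coe_insert, insert_subset_iff]
    exact ⟨hA, fun D hD => (hJ.mem D hD).1⟩
  · rw [extC, dif_pos hex, hx _ (Finset.mem_insert_self _ _),
      hJ.extU_eq fun D hD => hx D (Finset.mem_insert_of_mem hD), ← pointMass_diff, ← hAB]

theorem IsIndexingCollection.intersections_mem_differences (h𝒜 : IsIndexingCollection 𝒜)
    {F : Finset (Set T)} (hF : (F : Set (Set T)) ⊆ differences 𝒜) {C : Set T}
    (hC : C ∈ intersections F) : C ∈ differences 𝒜 := by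
  classical
  obtain ⟨G, hG, hne, rfl⟩ := mem_intersections.1 hC
  clear hC
  induction hne using Finset.Nonempty.cons_induction with
  | singleton C => simpa using hF (hG (Finset.mem_singleton_self C))
  | cons C G hCG _ ih =>
    obtain ⟨A, hA, B, hB, h⟩ := ih ((Finset.subset_cons hCG).trans hG)
    obtain ⟨A', hA', B', hB', h'⟩ := hF (hG (Finset.mem_cons_self C G))
    refine ⟨A' ∩ A, h𝒜.inter_mem hA' hA, B' ∪ B, union_mem_finiteUnions hB' hB, ?_⟩
    rw [Finset.coe_cons, sInter_insert, h, h']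
    ext p
    simp only [mem_inter_iff, Set.mem_sdiff, mem_union]
    tauto

namespace IsFlowSystem

variable {μ : Measure ℝ}
    {F : (n : ℕ) → (Fin (n + 1) → Set T) → Path T}
    {τ : (n : ℕ) → (Fin (n + 1) → Set T) → Fin (n + 1) → ℝ}
    {Qf : Path T → ℝ → ℝ → Kernel ℝ ℝ} {Ω : Type*} [MeasurableSpace Ω] {P : Measure Ω}
    {X : Set T → Ω → ℝ}

/-- Expectations of functions of finitely many values of the process are computed from the chain
along any ordering that contains the sites involved. -/
theorem lintegral_comp_eq {T : Type*} {𝒜 : Set (Set T)}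
    {F : (n : ℕ) → (Fin (n + 1) → Set T) → Path T} {Qf : Path T → ℝ → ℝ → Kernel ℝ ℝ}
    {X : Set T → Ω → ℝ} (hX : HasMarginals 𝒜 μ F Qf P X) {n : ℕ}
    {A : Fin (n + 1) → Set T} (hA : IsConsistentOrdering 𝒜 A) (J : Finset (Set T))
    (hJ𝒜 : ∀ D ∈ J, D ∈ 𝒜) (hJ : ∀ D ∈ J, D.Nonempty → ∃ i, i ≠ 0 ∧ A i = D)
    {f : (Set T → ℝ) → ℝ≥0∞} (hf : Measurable f) (hfJ : DependsOn f (J : Set (Set T))) :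
    ∫⁻ ω, f (fun D => X D ω) ∂P = ∫⁻ x, f (valueOf A x) ∂unionLaw 𝒜 μ F Qf A := by
  classical
  set e : (J → ℝ) → Set T → ℝ := fun u D => if h : D ∈ J then u ⟨D, h⟩ else 0 with he
  have hem : Measurable e := by
    refine measurable_pi_iff.2 fun D => ?_
    simp only [he]
    split_ifs <;> fun_prop
  have hfe : ∀ v w : Set T → ℝ, (∀ D ∈ J, v D = w D) → f (e (J.restrict v)) = f w := by
    intro v w hvw
    refine hfJ fun D hD => ?_
    simp only [he, dif_pos (Finset.mem_coe.1 hD), Finset.restrict]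
    exact hvw D hD
  have hXm : Measurable fun ω => J.restrict fun D => X D ω :=
    measurable_pi_iff.2 fun D => hX.measurable D
  calc ∫⁻ ω, f (fun D => X D ω) ∂P
      = ∫⁻ ω, f (e (J.restrict fun D => X D ω)) ∂P :=
        lintegral_congr fun ω => (hfe _ _ fun D _ => rfl).symm
    _ = ∫⁻ u, f (e u) ∂P.map (fun ω => J.restrict fun D => X D ω) :=
        (lintegral_map (hf.comp hem) hXm).symm
    _ = ∫⁻ x, f (e (J.restrict (𝒜.indicator (valueOf A x)))) ∂unionLaw 𝒜 μ F Qf A := by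
        rw [hX.map_eq hA J fun D hD _ => hJ D hD, valueLaw,
          Measure.map_map (Finset.measurable_restrict J) (measurable_indicator_valueOf 𝒜 A),
          lintegral_map (f := fun u => f (e u)) (hf.comp hem)
            ((Finset.measurable_restrict J).comp (measurable_indicator_valueOf 𝒜 A))]
        rfl
    _ = ∫⁻ x, f (valueOf A x) ∂unionLaw 𝒜 μ F Qf A :=
        lintegral_congr fun x => hfe _ _ fun D hD => indicator_of_mem (hJ𝒜 D hD) _

theorem minFiltration_le {T : Type*} {𝒜 : Set (Set T)}
    {F : (n : ℕ) → (Fin (n + 1) → Set T) → Path T} {Qf : Path T → ℝ → ℝ → Kernel ℝ ℝ}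
    {X : Set T → Ω → ℝ} (hX : HasMarginals 𝒜 μ F Qf P X) (B : Set T) :
    minFiltration 𝒜 X B ≤ ‹MeasurableSpace Ω› :=
  iSup₂_le fun D _ => (hX.measurable D).comap_le

variable [IsProbabilityMeasure μ]

/-- Almost surely, the process agrees with a point measure on any finitely many sets of `𝒜`. -/
theorem ae_exists_pointMass_eq [CompactSpace T] [Nonempty T] (h : IsFlowSystem 𝒜 μ F τ Qf)
    (hX : HasMarginals 𝒜 μ F Qf P X) (J : Finset (Set T)) (hJ𝒜 : (J : Set (Set T)) ⊆ 𝒜) :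
    ∀ᵐ ω ∂P, ∃ c, ∀ D ∈ J, X D ω = pointMass c D := by
  obtain ⟨n, A, hA, hJ, -⟩ := h.indexing.exists_ordering_isCut J hJ𝒜 (m := 0) Fin.elim0
    (fun a => a.elim0) (fun a => a.elim0) (fun a => a.elim0)
  set W := {v : Set T → ℝ | ∃ c, ∀ D ∈ J, v D = pointMass c D} with hW
  have hWm : MeasurableSet W := measurableSet_exists_pointMass J
  have hXm : Measurable fun ω D => X D ω := measurable_pi_iff.2 fun D => hX.measurable D
  have hdep : DependsOn (Wᶜ.indicator (1 : (Set T → ℝ) → ℝ≥0∞)) (J : Set (Set T)) := by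
    intro v w hvw
    have : v ∈ W ↔ w ∈ W := exists_congr fun c => forall₂_congr fun D hD => by rw [hvw D hD]
    by_cases hv : v ∈ W
    · simp [hv, this.1 hv]
    · simp [hv, mt this.2 hv]
  have key := lintegral_comp_eq hX hA J hJ𝒜 hJ (measurable_one.indicator hWm.compl) hdep
  have hzero : ∫⁻ x, Wᶜ.indicator (1 : (Set T → ℝ) → ℝ≥0∞) (valueOf A x)
      ∂unionLaw 𝒜 μ F Qf A = 0 := by
    refine (lintegral_eq_zero_iff
      ((measurable_one.indicator hWm.compl).comp (measurable_valueOf A))).2 ?_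
    filter_upwards [h.ae_exists_pointMass hA] with x hx
    obtain ⟨c, hc⟩ := hx
    have : valueOf A x ∈ W := ⟨c, fun D hD => hA.valueOf_eq_pointMass hc (hJ D hD)⟩
    simp [this]
  rw [hzero] at key
  filter_upwards [(lintegral_eq_zero_iff
    ((measurable_one.indicator hWm.compl).comp hXm)).1 key] with ω hω
  by_contra hcon
  have : (fun D => X D ω) ∈ Wᶜ := hcon
  simp [this] at hω

theorem hasUniqueAdditiveExtension [CompactSpace T] [Nonempty T] (h : IsFlowSystem 𝒜 μ F τ Qf)
    (hX : HasMarginals 𝒜 μ F Qf P X) : HasUniqueAdditiveExtension 𝒜 P X where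
  toU G G' hG hG' heq := by
    classical
    filter_upwards [h.ae_exists_pointMass_eq hX (intersections G ∪ intersections G') (by
      intro D hD
      rcases Finset.mem_union.1 hD with hD | hD
      · exact (h.indexing.intersections_mem hG hD).1
      · exact (h.indexing.intersections_mem hG' hD).1)] with ω hω
    obtain ⟨c, hc⟩ := hω
    rw [inclExcl_eq_pointMass fun D hD => hc D (Finset.mem_union_left _ hD),
      inclExcl_eq_pointMass fun D hD => hc D (Finset.mem_union_right _ hD), heq]
  toC A hA A' hA' B hB B' hB' heq := by
    classical
    obtain ⟨J, hJ⟩ := h.indexing.exists_determines (inter_mem_finiteUnions h.indexing hA hB)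
    obtain ⟨J', hJ'⟩ := h.indexing.exists_determines (inter_mem_finiteUnions h.indexing hA' hB')
    filter_upwards [h.ae_exists_pointMass_eq hX (insert A (insert A' (J ∪ J'))) (by
      intro D hD
      simp only [Finset.coe_insert, Finset.coe_union, mem_insert_iff, mem_union,
        Finset.mem_coe] at hD
      rcases hD with rfl | rfl | hD | hD
      · exact hA
      · exact hA'
      · exact (hJ.mem D hD).1
      · exact (hJ'.mem D hD).1)] with ω hω
    obtain ⟨c, hc⟩ := hω
    rw [hc A (by simp), hc A' (by simp), hJ.extU_eq fun D hD => hc D (by simp [hD]),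
      hJ'.extU_eq fun D hD => hc D (by simp [hD]), ← pointMass_diff, ← pointMass_diff, heq]
  toCu G G' hG hG' heq := by
    classical
    have hdiff : ∀ C ∈ intersections G ∪ intersections G', C ∈ differences 𝒜 := by
      intro C hC
      rcases Finset.mem_union.1 hC with hC | hC
      · exact h.indexing.intersections_mem_differences hG hC
      · exact h.indexing.intersections_mem_differences hG' hC
    choose! J hJ hJext using fun C hC => h.indexing.exists_extC_eq (hdiff C hC)
    filter_upwards [h.ae_exists_pointMass_eq hX
      ((intersections G ∪ intersections G').biUnion J) (by
        intro D hD
        obtain ⟨C, hC, hD⟩ := Finset.mem_biUnion.1 (Finset.mem_coe.1 hD)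
        exact hJ C hC hD)] with ω hω
    obtain ⟨c, hc⟩ := hω
    have hval : ∀ C ∈ intersections G ∪ intersections G',
        extC 𝒜 (fun A => X A ω) C = pointMass c C := fun C hC =>
      hJext C hC _ c fun D hD => hc D (Finset.mem_biUnion.2 ⟨C, hC, hD⟩)
    rw [inclExcl_eq_pointMass fun C hC => hval C (Finset.mem_union_left _ hC),
      inclExcl_eq_pointMass fun C hC => hval C (Finset.mem_union_right _ hC), heq]

end IsFlowSystem

end

/-! ### The Markov property -/

section

namespace IsFlowSystem

variable {T : Type*} [TopologicalSpace T] [CompactSpace T] [Nonempty T] {𝒜 : Set (Set T)}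
    {μ : Measure ℝ} [IsProbabilityMeasure μ]
    {F : (n : ℕ) → (Fin (n + 1) → Set T) → Path T}
    {τ : (n : ℕ) → (Fin (n + 1) → Set T) → Fin (n + 1) → ℝ}
    {Qf : Path T → ℝ → ℝ → Kernel ℝ ℝ} {Ω : Type*} [MeasurableSpace Ω] {P : Measure Ω}
    {X : Set T → Ω → ℝ}

/-- The Markov property of the process, tested on functions of finitely many values in the past,
between two sets on which an ordering is cut. -/
theorem lintegral_valueOf_mul (h : IsFlowSystem 𝒜 μ F τ Qf) {n : ℕ} {A : Fin (n + 1) → Set T}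
    (hA : IsConsistentOrdering 𝒜 A) {J : Finset (Set T)} {k l : Fin (n + 1)} (hkl : k ≤ l)
    (hJ : ∀ D ∈ J, ∀ j, j ≠ 0 → A j ⊆ D → j ≤ k) {g : (Set T → ℝ) → ℝ≥0∞} (hg : Measurable g)
    (hgJ : DependsOn g (J : Set (Set T))) {f : ℝ → ℝ≥0∞} (hf : Measurable f) :
    ∫⁻ x, g (valueOf A x) * f (x l) ∂unionLaw 𝒜 μ F Qf A =
      ∫⁻ x, g (valueOf A x) * ∫⁻ y, f y ∂setKernel 𝒜 μ (chosenFlows 𝒜 F) Qf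
        (initialUnion A k) (initialUnion A l) (x k) ∂unionLaw 𝒜 μ F Qf A := by
  have := h.isMarkovKernel_setKernel
  refine lintegral_chainLaw_mul h.isTransitionSystem_setKernel μ (initialUnion A)
    (monotone_initialUnion A) (initialUnion_mem_finiteUnions h.indexing hA) hkl
    (hg.comp (measurable_valueOf A)) ?_ hf
  intro x y hxy
  exact hgJ fun D hD => valueOf_congr (hJ D hD) fun i hi => hxy i hi

/-- Additivity along the chain: at a cut `B = A 0 ∪ … ∪ A k`, the inclusion-exclusion extension of
the values gives back the `k`-th state. -/
theorem extU_valueOf_ae_eq (h : IsFlowSystem 𝒜 μ F τ Qf) {n : ℕ} {A : Fin (n + 1) → Set T}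
    (hA : IsConsistentOrdering 𝒜 A) {B : Set T} {J : Finset (Set T)} (hB : Determines 𝒜 B J)
    (hJ : ∀ D ∈ J, D.Nonempty → ∃ i, i ≠ 0 ∧ A i = D) {k : Fin (n + 1)}
    (hk : initialUnion A k = B) :
    ∀ᵐ x ∂unionLaw 𝒜 μ F Qf A, extU 𝒜 (valueOf A x) B = x k := by
  filter_upwards [h.ae_exists_pointMass hA] with x hx
  obtain ⟨c, hc⟩ := hx
  rw [hB.extU_eq fun D hD => hA.valueOf_eq_pointMass hc (hJ D hD), ← hk, hc]

/-- The Markov property of the process, tested on functions of finitely many values in the past. -/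
theorem lintegral_markov (h : IsFlowSystem 𝒜 μ F τ Qf) (hX : HasMarginals 𝒜 μ F Qf P X)
    {B B' : Set T} (hB : B ∈ finiteUnions 𝒜) (hB' : B' ∈ finiteUnions 𝒜) (hBB' : B ⊆ B')
    {J : Finset (Set T)} (hJ : ∀ D ∈ J, D ∈ 𝒜 ∧ D ⊆ B) {g : (Set T → ℝ) → ℝ≥0∞}
    (hg : Measurable g) (hgJ : DependsOn g (J : Set (Set T))) {f : ℝ → ℝ≥0∞}
    (hf : Measurable f) :
    ∫⁻ ω, g (fun D => X D ω) * f (valueAt 𝒜 X B' ω) ∂P =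
      ∫⁻ ω, g (fun D => X D ω) * ∫⁻ y, f y
        ∂setKernel 𝒜 μ (chosenFlows 𝒜 F) Qf B B' (valueAt 𝒜 X B ω) ∂P := by
  classical
  have := h.isMarkovKernel_setKernel
  obtain ⟨JB, hJB⟩ := h.indexing.exists_determines hB
  obtain ⟨JB', hJB'⟩ := h.indexing.exists_determines hB'
  have hmeas : ∀ {C : Set T}, C ∈ finiteUnions 𝒜 → Measurable fun v : Set T → ℝ => extU 𝒜 v C :=
    fun hC => h.indexing.measurable_extU hC _ (fun D (v : Set T → ℝ) => v D)
      fun D _ _ => measurable_pi_apply D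
  set J' : Finset (Set T) := J ∪ (JB ∪ JB') with hJ'
  have hJ'𝒜 : ∀ D ∈ J', D ∈ 𝒜 := by
    intro D hD
    simp only [hJ', Finset.mem_union] at hD
    rcases hD with hD | hD | hD
    · exact (hJ D hD).1
    · exact (hJB.mem D hD).1
    · exact (hJB'.mem D hD).1
  have hdep : ∀ {f₁ : ℝ → ℝ≥0∞} {C : Set T} {K : Finset (Set T)}, Determines 𝒜 C K →
      K ⊆ J' → DependsOn (fun v : Set T → ℝ => g v * f₁ (extU 𝒜 v C)) (J' : Set (Set T)) := by
    intro f₁ C K hC hK v w hvw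
    have h1 : g v = g w := hgJ fun D hD => hvw D (Finset.mem_union_left _ hD)
    have h2 : extU 𝒜 v C = extU 𝒜 w C := hC.dependsOn fun D hD => hvw D (hK hD)
    simp only [h1, h2]
  have hJBJ' : JB ⊆ J' := Finset.subset_union_left.trans Finset.subset_union_right
  have hJB'J' : JB' ⊆ J' := Finset.subset_union_right.trans Finset.subset_union_right
  set κ := setKernel 𝒜 μ (chosenFlows 𝒜 F) Qf B B' with hκ
  have hκm : Measurable fun x => ∫⁻ y, f y ∂κ x := hf.lintegral_kernel
  rcases B'.eq_empty_or_nonempty with rfl | hne'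
  · obtain rfl : B = ∅ := subset_empty_iff.1 hBB'
    simp only [hκ, h.setKernel_refl hB, Kernel.id_apply, lintegral_dirac' _ hf]
  -- both sides are computed along an ordering that is cut at `B` (if non-empty) and `B'`
  have hcomp : ∀ {n : ℕ} {A : Fin (n + 1) → Set T}, IsConsistentOrdering 𝒜 A →
      (∀ D ∈ J', D.Nonempty → ∃ i, i ≠ 0 ∧ A i = D) →
      ∀ {f₁ : ℝ → ℝ≥0∞} {C : Set T} {K : Finset (Set T)}, Measurable f₁ → C ∈ finiteUnions 𝒜 →
      Determines 𝒜 C K → K ⊆ J' → ∫⁻ ω, g (fun D => X D ω) * f₁ (valueAt 𝒜 X C ω) ∂P =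
        ∫⁻ x, g (valueOf A x) * f₁ (extU 𝒜 (valueOf A x) C) ∂unionLaw 𝒜 μ F Qf A :=
    fun {_ _} hA hAJ {_ _ _} hf₁ hC hCK hK => lintegral_comp_eq hX hA J' hJ'𝒜 hAJ
      (hg.mul (hf₁.comp (hmeas hC))) (hdep hCK hK)
  rcases B.eq_empty_or_nonempty with rfl | hne
  · obtain ⟨n, A, hA, hAJ, hcut⟩ := h.indexing.exists_ordering_isCut J' hJ'𝒜
      (fun _ : Fin 1 => B') (fun _ _ _ => le_rfl) (fun _ => hB') (fun _ => hne')
    obtain ⟨l, hl⟩ := hcut 0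
    have hconst : ∀ x, g (valueOf A x) = g 0 := fun x => hgJ fun D hD => by
      rw [subset_empty_iff.1 (hJ D hD).2, hA.valueOf_empty, Pi.zero_apply]
    have hJ0 : ∀ D ∈ J, ∀ j, j ≠ 0 → A j ⊆ D → j ≤ 0 := fun D hD j hj hjD =>
      absurd (subset_empty_iff.1 (hjD.trans (hJ D hD).2)) (hA.nonempty j hj).ne_empty
    have := h.isMarkovKernel_flowKernel
    have hκ' : ∀ x, ∫⁻ y, f y ∂κ x =
        ∫⁻ z, ∫⁻ y, f y ∂flowKernel (chosenFlows 𝒜 F) Qf (minimalSet 𝒜) B' z ∂μ := by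
      intro x
      rw [hκ, setKernel, if_pos ⟨rfl, hne'.ne_empty⟩, Kernel.lintegral_comp _ _ _ hf,
        Kernel.const_apply]
    have hprob := h.isProbabilityMeasure_unionLaw A
    rw [hcomp hA hAJ hf hB' hJB' hJB'J', hcomp hA hAJ hκm hB hJB hJBJ']
    have hae : ∀ᵐ x ∂unionLaw 𝒜 μ F Qf A, g (valueOf A x) * f (extU 𝒜 (valueOf A x) B') =
        g (valueOf A x) * f (x l) := by
      filter_upwards [h.extU_valueOf_ae_eq hA hJB' (fun D hD => hAJ D (hJB'J' hD))
        hl.initialUnion_eq] with x hx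
      rw [hx]
    rw [lintegral_congr_ae hae, h.lintegral_valueOf_mul hA (Fin.zero_le l) hJ0 hg hgJ hf]
    simp only [hκ', hconst, lintegral_const, measure_univ, mul_one, initialUnion_zero, hA.zero,
      hl.initialUnion_eq, setKernel_of_nonempty h.indexing.minimalSet_nonempty]
    have h0 : (unionLaw 𝒜 μ F Qf A).map (fun x => x 0) = μ := map_chainLaw_zero μ n _
    have h1 := lintegral_map (μ := unionLaw 𝒜 μ F Qf A) (hf.lintegral_kernel
      (κ := flowKernel (chosenFlows 𝒜 F) Qf (minimalSet 𝒜) B')) (measurable_pi_apply 0)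
    rw [h0] at h1
    rw [h1]
    exact lintegral_const_mul _ (hf.lintegral_kernel.comp (measurable_pi_apply 0))
  · obtain ⟨n, A, hA, hAJ, hcut⟩ := h.indexing.exists_ordering_isCut J' hJ'𝒜 ![B, B']
      (by
        refine Fin.monotone_iff_le_succ.2 fun i => ?_
        fin_cases i
        exact hBB')
      (by intro a; fin_cases a <;> assumption) (by intro a; fin_cases a <;> assumption)
    obtain ⟨k, hk⟩ : ∃ k, IsCut A B k := hcut 0
    obtain ⟨l, hl⟩ : ∃ l, IsCut A B' l := hcut 1
    rw [hcomp hA hAJ hf hB' hJB' hJB'J', hcomp hA hAJ hκm hB hJB hJBJ']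
    have hae : ∀ᵐ x ∂unionLaw 𝒜 μ F Qf A, g (valueOf A x) * f (extU 𝒜 (valueOf A x) B') =
        g (valueOf A x) * f (x l) := by
      filter_upwards [h.extU_valueOf_ae_eq hA hJB' (fun D hD => hAJ D (hJB'J' hD))
        hl.initialUnion_eq] with x hx
      rw [hx]
    have hae' : ∀ᵐ x ∂unionLaw 𝒜 μ F Qf A,
        g (valueOf A x) * ∫⁻ y, f y ∂κ (extU 𝒜 (valueOf A x) B) =
        g (valueOf A x) * ∫⁻ y, f y ∂κ (x k) := by
      filter_upwards [h.extU_valueOf_ae_eq hA hJB (fun D hD => hAJ D (hJBJ' hD))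
        hk.initialUnion_eq] with x hx
      rw [hx]
    rw [lintegral_congr_ae hae, lintegral_congr_ae hae', h.lintegral_valueOf_mul hA
      (hk.le hl hBB') (fun D hD j hj hjD => (hk.subset_iff j hj).1 (hjD.trans (hJ D hD).2)) hg hgJ
      hf, hk.initialUnion_eq, hl.initialUnion_eq]

/-- The Markov property of the process, tested on all events of the past. -/
theorem measure_inter_eq [IsProbabilityMeasure P] (h : IsFlowSystem 𝒜 μ F τ Qf)
    (hX : HasMarginals 𝒜 μ F Qf P X) {B B' : Set T} (hB : B ∈ finiteUnions 𝒜)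
    (hB' : B' ∈ finiteUnions 𝒜) (hBB' : B ⊆ B') {Γ : Set ℝ} (hΓ : MeasurableSet Γ) {S : Set Ω}
    (hS : MeasurableSet[minFiltration 𝒜 X B] S) :
    P (S ∩ valueAt 𝒜 X B' ⁻¹' Γ) =
      ∫⁻ ω in S, setKernel 𝒜 μ (chosenFlows 𝒜 F) Qf B B' (valueAt 𝒜 X B ω) Γ ∂P := by
  classical
  set κ := setKernel 𝒜 μ (chosenFlows 𝒜 F) Qf B B' with hκ
  have hle := minFiltration_le hX B
  have hYm : Measurable (valueAt 𝒜 X B) := (h.indexing.measurable_valueAt hB X).mono hle le_rfl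
  have hY'm : Measurable (valueAt 𝒜 X B') :=
    (h.indexing.measurable_valueAt hB' X).mono (minFiltration_le hX B') le_rfl
  have hκm : Measurable fun ω => κ (valueAt 𝒜 X B ω) Γ := (κ.measurable_coe hΓ).comp hYm
  -- the events determined by finitely many values in the past
  have hcyl : ∀ (J : Finset (Set T)), (∀ D ∈ J, D ∈ 𝒜 ∧ D ⊆ B) → ∀ Θ : Set T → Set ℝ,
      (∀ D ∈ J, MeasurableSet (Θ D)) → ∀ S : Set Ω, S = ⋂ D ∈ J, X D ⁻¹' Θ D →
      P (S ∩ valueAt 𝒜 X B' ⁻¹' Γ) = ∫⁻ ω in S, κ (valueAt 𝒜 X B ω) Γ ∂P := by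
    rintro J hJ Θ hΘ S rfl
    set V : Set (Set T → ℝ) := ⋂ D ∈ J, (fun v => v D) ⁻¹' Θ D with hV
    have hVm : MeasurableSet V :=
      J.measurableSet_biInter fun D hD => measurable_pi_apply D (hΘ D hD)
    have hVJ : DependsOn (V.indicator (1 : (Set T → ℝ) → ℝ≥0∞)) (J : Set (Set T)) := by
      intro v w hvw
      have : v ∈ V ↔ w ∈ V := by
        simp only [hV, mem_iInter, mem_preimage]
        exact forall₂_congr fun D hD => by rw [hvw D hD]
      by_cases hv : v ∈ V
      · simp [hv, this.1 hv]
      · simp [hv, mt this.2 hv]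
    have key := h.lintegral_markov hX hB hB' hBB' hJ (measurable_one.indicator hVm) hVJ
      (measurable_one.indicator hΓ)
    have hSm : MeasurableSet (⋂ D ∈ J, X D ⁻¹' Θ D) :=
      J.measurableSet_biInter fun D hD => hX.measurable D (hΘ D hD)
    have hmem : ∀ ω, (fun D => X D ω) ∈ V ↔ ω ∈ ⋂ D ∈ J, X D ⁻¹' Θ D := fun ω => by
      simp [hV]
    rw [← lintegral_indicator_one (hSm.inter (hY'm hΓ)), ← lintegral_indicator hSm]
    refine Eq.trans (lintegral_congr fun ω => ?_) (key.trans (lintegral_congr fun ω => ?_))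
    · by_cases h1 : ω ∈ ⋂ D ∈ J, X D ⁻¹' Θ D <;> by_cases h2 : valueAt 𝒜 X B' ω ∈ Γ <;>
        simp only [indicator, hmem, mem_inter_iff, mem_preimage, h1, h2, if_true, if_false,
          Pi.one_apply, and_self, and_false, false_and, mul_one, mul_zero]
    · rw [lintegral_indicator_one hΓ]
      by_cases h1 : ω ∈ ⋂ D ∈ J, X D ⁻¹' Θ D <;>
        simp only [indicator, hmem, h1, if_true, if_false,
          Pi.one_apply, one_mul, zero_mul, hκ]
  have hgen : minFiltration 𝒜 X B = MeasurableSpace.generateFrom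
      (piiUnionInter (fun D => {s | MeasurableSet[MeasurableSpace.comap (X D) (borel ℝ)] s})
        {D | D ∈ 𝒜 ∧ D ⊆ B}) :=
    (generateFrom_piiUnionInter_measurableSet _ _).symm
  have hpi := isPiSystem_piiUnionInter
    (fun D => {s | MeasurableSet[MeasurableSpace.comap (X D) (borel ℝ)] s})
    (fun D => @MeasurableSpace.isPiSystem_measurableSet _ (MeasurableSpace.comap (X D) (borel ℝ)))
    {D | D ∈ 𝒜 ∧ D ⊆ B}
  have hext := ext_on_measurableSpace_of_generate_finite _
    (μ := P.restrict (valueAt 𝒜 X B' ⁻¹' Γ))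
    (ν := P.withDensity fun ω => κ (valueAt 𝒜 X B ω) Γ) _ ?_ hle hgen hpi ?_ hS
  · rw [Measure.restrict_apply (hle _ hS), withDensity_apply _ (hle _ hS)] at hext
    exact hext
  · rintro s ⟨J, hJ, Θ', hΘ', rfl⟩
    choose! Θ hΘ hΘe using fun D (hD : D ∈ J) => MeasurableSpace.measurableSet_comap.1 (hΘ' D hD)
    have hs : ⋂ D ∈ J, Θ' D = ⋂ D ∈ J, X D ⁻¹' Θ D :=
      iInter₂_congr fun D hD => (hΘe D hD).symm
    have hsm : MeasurableSet (⋂ D ∈ J, Θ' D) := by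
      rw [hs]
      exact J.measurableSet_biInter fun D hD => hX.measurable D (hΘ D hD)
    rw [Measure.restrict_apply hsm, withDensity_apply _ hsm]
    exact hcyl J (fun D hD => hJ hD) Θ hΘ _ hs
  · rw [Measure.restrict_apply .univ, withDensity_apply _ .univ]
    exact hcyl ∅ (by simp) (fun _ => univ) (by simp) univ (by simp)

theorem markovWith [IsProbabilityMeasure P] (h : IsFlowSystem 𝒜 μ F τ Qf)
    (hX : HasMarginals 𝒜 μ F Qf P X) :
    MarkovWith P (finiteUnions 𝒜) (minFiltration 𝒜 X) (valueAt 𝒜 X)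
      (setKernel 𝒜 μ (chosenFlows 𝒜 F) Qf) := by
  intro B hB B' hB' hBB' Γ hΓ
  have := h.isMarkovKernel_setKernel
  set κ := setKernel 𝒜 μ (chosenFlows 𝒜 F) Qf B B' with hκ
  have hle := minFiltration_le hX B
  have hY'm : Measurable (valueAt 𝒜 X B') :=
    (h.indexing.measurable_valueAt hB' X).mono (minFiltration_le hX B') le_rfl
  have hm : Measurable[minFiltration 𝒜 X B] fun ω => (κ (valueAt 𝒜 X B ω)).real Γ :=
    ((κ.measurable_coe hΓ).ennreal_toReal).comp (h.indexing.measurable_valueAt hB X)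
  have hint : Integrable (fun ω => (κ (valueAt 𝒜 X B ω)).real Γ) P :=
    Integrable.of_bound (hm.mono hle le_rfl).aestronglyMeasurable 1
      (ae_of_all _ fun ω => by
        rw [Real.norm_of_nonneg measureReal_nonneg]
        exact measureReal_le_one)
  refine (ae_eq_condExp_of_forall_setIntegral_eq hle
    ((integrable_const 1).indicator (hY'm hΓ)) (fun s _ _ => hint.integrableOn) (fun S hS _ => ?_)
    hm.aestronglyMeasurable).symm
  have hSm : MeasurableSet S := hle _ hS
  rw [setIntegral_indicator (hY'm hΓ), setIntegral_const, smul_eq_mul, mul_one]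
  simp only [measureReal_def]
  rw [h.measure_inter_eq hX hB hB' hBB' hΓ hS]
  exact integral_toReal
    ((κ.measurable_coe hΓ).comp ((h.indexing.measurable_valueAt hB X).mono hle le_rfl)).aemeasurable
    (ae_of_all _ fun ω => measure_lt_top _ _)

theorem map_minimalSet (h : IsFlowSystem 𝒜 μ F τ Qf) (hX : HasMarginals 𝒜 μ F Qf P X) :
    P.map (X (minimalSet 𝒜)) = μ := by
  obtain ⟨n, A, hA, hAJ, -⟩ := h.indexing.exists_ordering_isCut {minimalSet 𝒜}
    (by simpa using h.indexing.minimalSet_mem) (m := 0) Fin.elim0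
    (fun a => a.elim0) (fun a => a.elim0) (fun a => a.elim0)
  have h0 : (unionLaw 𝒜 μ F Qf A).map (fun x => x 0) = μ := by
    have := h.isMarkovKernel_setKernel
    exact map_chainLaw_zero μ n _
  ext Γ hΓ
  have key := lintegral_comp_eq hX hA {minimalSet 𝒜} (by simpa using h.indexing.minimalSet_mem)
    hAJ (f := fun v => Γ.indicator 1 (v (minimalSet 𝒜)))
    ((measurable_one.indicator hΓ).comp (measurable_pi_apply _))
    (fun v w hvw => by
      have : v (minimalSet 𝒜) = w (minimalSet 𝒜) := hvw _ (by simp)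
      simp only [this])
  have hae : ∀ᵐ x ∂unionLaw 𝒜 μ F Qf A, Γ.indicator (1 : ℝ → ℝ≥0∞)
      (valueOf A x (minimalSet 𝒜)) = Γ.indicator 1 (x 0) := by
    filter_upwards [h.ae_exists_pointMass hA] with x hx
    obtain ⟨c, hc⟩ := hx
    rw [hA.valueOf_eq_pointMass hc (hAJ _ (by simp)), ← hc 0, initialUnion_zero, hA.zero]
  rw [lintegral_congr_ae hae,
    ← lintegral_map (f := Γ.indicator 1) (measurable_one.indicator hΓ) (hX.measurable _),
    ← lintegral_map (f := Γ.indicator 1) (g := fun x : Fin (n + 1) → ℝ => x 0)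
      (measurable_one.indicator hΓ) (measurable_pi_apply 0), h0, lintegral_indicator_one hΓ,
    lintegral_indicator_one hΓ] at key
  exact key

theorem isQMarkov [IsProbabilityMeasure P] (h : IsFlowSystem 𝒜 μ F τ Qf)
    (hX : HasMarginals 𝒜 μ F Qf P X) :
    IsQMarkov 𝒜 P X (setKernel 𝒜 μ (chosenFlows 𝒜 F) Qf) where
  measurable D _ := hX.measurable D
  additive := h.hasUniqueAdditiveExtension hX
  markov := h.markovWith hX

theorem isQMarkovAlong [IsProbabilityMeasure P] (h : IsFlowSystem 𝒜 μ F τ Qf)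
    (hX : HasMarginals 𝒜 μ F Qf P X) {f : Path T} (hf : f ∈ chosenFlows 𝒜 F) :
    IsQMarkovAlong 𝒜 P X f (Qf f) := by
  intro s hs t ht hst Γ hΓ
  have := h.markovWith hX (f.toFun s) (h.toFun_mem hf hs) (f.toFun t) (h.toFun_mem hf ht)
    (h.toFun_mono hf hs ht hst) Γ hΓ
  rwa [h.setKernel_eq hf hs ht hst] at this

end IsFlowSystem

end

end SetIndexed

end

theorem corollary1 {T : Type u} [TopologicalSpace T] [CompactSpace T] [T2Space T] [Nonempty T]
    (𝒜 : Set (Set T)) (h𝒜 : SetIndexed.IsIndexingCollection 𝒜)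
    (μ : Measure ℝ) [IsProbabilityMeasure μ]
    -- the chosen flow `F n A` and its partition `τ n A`, for each consistent ordering `A`
    (F : (n : ℕ) → (Fin (n + 1) → Set T) → SetIndexed.Path T)
    (τ : (n : ℕ) → (Fin (n + 1) → Set T) → Fin (n + 1) → ℝ)
    (hF : ∀ (n : ℕ) (A : Fin (n + 1) → Set T), SetIndexed.IsConsistentOrdering 𝒜 A →
      SetIndexed.Connects 𝒜 A (F n A) (τ n A))
    -- the one-dimensional transition systems
    (Qf : SetIndexed.Path T → ℝ → ℝ → Kernel ℝ ℝ)
    (hQf : ∀ f ∈ SetIndexed.chosenFlows 𝒜 F,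
      SetIndexed.IsTransitionSystem (Set.Icc 0 f.a) (Qf f))
    (hmatching : SetIndexed.Matching (SetIndexed.chosenFlows 𝒜 F) Qf)
    (hconsistency : SetIndexed.Consistency 𝒜 μ F τ Qf) :
    ∃ Q : Set T → Set T → Kernel ℝ ℝ,
      SetIndexed.IsTransitionSystem (SetIndexed.finiteUnions 𝒜) Q ∧
      ∃ (Ω : Type u) (_ : MeasurableSpace Ω) (P : Measure Ω) (X : Set T → Ω → ℝ),
        IsProbabilityMeasure P ∧ P.IsComplete ∧
        SetIndexed.IsQMarkov 𝒜 P X Q ∧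
        P.map (X (SetIndexed.minimalSet 𝒜)) = μ ∧
        ∀ f ∈ SetIndexed.chosenFlows 𝒜 F, SetIndexed.IsQMarkovAlong 𝒜 P X f (Qf f) := by
  have h : SetIndexed.IsFlowSystem 𝒜 μ F τ Qf := ⟨h𝒜, hF, hQf, hmatching, hconsistency⟩
  obtain ⟨Ω, mΩ, P, X, hP, hcomplete, hX⟩ := h.exists_hasMarginals
  exact ⟨_, h.isTransitionSystem_setKernel, Ω, mΩ, P, X, hP, hcomplete, h.isQMarkov hX,
    h.map_minimalSet hX, fun f hf => h.isQMarkovAlong hX hf⟩
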